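/- Let $d\ge 2$ and write $\mathbb I=[0,1]$. A $d$-dimensional copula is the distribution function $C(\mathbf x)=\mu_C([\mathbf 0,\mathbf x])$, $\mathbf x\in\mathbb I^d$, of a Borel probability measure $\mu_C$ on $\mathbb I^d$ with uniform one-dimensional marginals. It is Archimedean if there is a continuous, non-increasing $\psi:[0,\infty)\to\mathbb I$ with $\psi(0)=1$ and $\lim_{z\to\infty}\psi(z)=0$, strictly decreasing on the set of all $z\in[0,\infty)$ with $z\le\inf\{w\in[0,\infty]:\psi(w)=0\}$ (where $\psi(\infty):=0$), such that $C(\mathbf x)=\psi(\varphi(x_1)+\cdots+\varphi(x_d))$ for all $\mathbf x\in\mathbb I^d$; here $\varphi(t)=\inf\{z\in[0,\infty]:\psi(z)=t\}$ is the pseudoinverse of $\psi$. For $1\le\ell\le d-1$ let $C^{1:\ell}$ denote the marginal copula of the first $\ell$ coordinates. An $\ell$-Markov kernel of $C$ is (any version of) the regular conditional distribution of the last $d-\ell$ coordinates given the first $\ell$ coordinates under $\mu_C$, that is, a Markov kernel $K$ from $\mathbb I^\ell$ to $\mathbb I^{d-\ell}$ with $\mu_C(E\times F)=\int_E K(\mathbf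 x,F)\,\mathrm d\mu_{C^{1:\ell}}(\mathbf x)$ for all Borel sets $E\subseteq\mathbb I^\ell$, $F\subseteq\mathbb I^{d-\ell}$. Let $C,C_1,C_2,\ldots$ be $d$-dimensional Archimedean copulas such that $(C_n)_{n\in\mathbb N}$ converges to $C$ uniformly on $\mathbb I^d$. Let $\ell\in\{1,\ldots,d-1\}$ and let $K,K_1,K_2,\ldots$ be arbitrary $\ell$-Markov kernels of $C,C_1,C_2,\ldots$, respectively. Then there is a Borel set $\Lambda\subseteq\mathbb I^\ell$ with $\mu_{C^{1:\ell}}(\Lambda)=1$ such that for every $\mathbf x\in\Lambda$: 1. there is a dense subset $U^{\mathbf x}$ of $\mathbb I^{d-\ell}$ such that $\lim_{n\to\infty}K_n(\mathbf x,[\mathbf 0,\mathbf y])=K(\mathbf x,[\mathbf 0,\mathbf y])$ for every $\mathbf y\in U^{\mathbf x}$; 2. the probability measures $K_n(\mathbf x,\cdot)$ converge weakly to $K(\mathbf x,\cdot)$, i.e. $(C_n)_{n\in\mathbb N}$ converges $\ell$-weakly conditional to $C$. -/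

import Mathlib

open MeasureTheory ProbabilityTheory Filter Set
open scoped Topology unitInterval ENNReal

/-- A `d`-dimensional copula, given by its `d`-stochastic measure: a probability measure on the
unit cube all of whose one-dimensional marginals are uniform. The copula as a function on the cube
is the distribution function of this measure (see the coercion below); the measure and the function
determine each other. -/
structure Copula (d : ℕ) where
  /-- the `d`-stochastic measure of the copula -/
  measure : Measure (Fin d → I)
  isProbabilityMeasure : IsProbabilityMeasure measure
  map_eval : ∀ i, measure.map (fun x => x i) = volume

namespace Copula

instance {d : ℕ} (C : Copula d) : IsProbabilityMeasure C.measure := C.isProbabilityMeasure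

/-- The copula as a function: `C x` is the mass of the box `[0, x]`. -/
noncomputable instance {d : ℕ} : CoeFun (Copula d) (fun _ => (Fin d → I) → ℝ) :=
  ⟨fun C x => C.measure.real (Iic x)⟩

/-- The first `ℓ` coordinates of a point of the `d`-dimensional cube. -/
def initial {d ℓ : ℕ} (h : ℓ ≤ d) (x : Fin d → I) : Fin ℓ → I :=
  fun i => x (Fin.castLE h i)

/-- The last `d - ℓ` coordinates of a point of the `d`-dimensional cube. -/
def final {d ℓ : ℕ} (x : Fin d → I) : Fin (d - ℓ) → I :=
  fun j => x ⟨ℓ + j, Nat.add_lt_of_lt_sub' j.isLt⟩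

theorem measurable_initial {d ℓ : ℕ} (h : ℓ ≤ d) : Measurable (initial h) :=
  measurable_pi_lambda _ fun _ => measurable_pi_apply _

/-- The marginal copula of the first `ℓ` coordinates. -/
noncomputable def marginal {d ℓ : ℕ} (C : Copula d) (h : ℓ ≤ d) : Copula ℓ where
  measure := C.measure.map (initial h)
  isProbabilityMeasure := Measure.isProbabilityMeasure_map (measurable_initial h).aemeasurable
  map_eval i := by
    rw [Measure.map_map (measurable_pi_apply i) (measurable_initial h)]
    exact C.map_eval (Fin.castLE h i)

/-- The measure of the copula, with the cube written as the product of the cube of the first `ℓ`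
coordinates and the cube of the remaining `d - ℓ` coordinates. -/
noncomputable def splitMeasure {d ℓ : ℕ} (C : Copula d) (h : ℓ ≤ d) :
    Measure ((Fin ℓ → I) × (Fin (d - ℓ) → I)) :=
  C.measure.map (fun x => (initial h x, final x))

/-- `K` is (a version of) the `ℓ`-Markov kernel of `C`: a Markov kernel that is a regular
conditional distribution of the last `d - ℓ` coordinates given the first `ℓ` ones. -/
structure IsMarkovKernelOf {d ℓ : ℕ} (C : Copula d) (h : ℓ ≤ d)
    (K : Kernel (Fin ℓ → I) (Fin (d - ℓ) → I)) : Prop where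
  isMarkovKernel : IsMarkovKernel K
  disintegrate : (C.marginal h).measure ⊗ₘ K = C.splitMeasure h

end Copula

/-- `ψ`, considered on `[0, ∞)` only, is an Archimedean generator. The last field says that `ψ` is
strictly decreasing up to `inf {z ∈ [0, ∞] | ψ z = 0}`. -/
structure IsArchimedeanGenerator (ψ : ℝ → ℝ) : Prop where
  mem_Icc : ∀ z, 0 ≤ z → ψ z ∈ Icc (0 : ℝ) 1
  continuousOn : ContinuousOn ψ (Ici 0)
  antitoneOn : AntitoneOn ψ (Ici 0)
  map_zero : ψ 0 = 1
  tendsto_atTop : Tendsto ψ atTop (𝓝 0)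
  strictAntiOn : StrictAntiOn ψ {z | 0 ≤ z ∧ ∀ w, 0 ≤ w → ψ w = 0 → z ≤ w}

/-- The extension of a generator to `[0, ∞]` by `ψ ∞ = 0`. -/
noncomputable def generatorExt (ψ : ℝ → ℝ) (z : ℝ≥0∞) : ℝ :=
  if z = ∞ then 0 else ψ z.toReal

/-- The pseudoinverse `φ` of a generator. For `0 < x ≤ 1` it is the unique preimage of `x`, and
`φ 0 = inf {z ∈ [0, ∞] | ψ z = 0}`. -/
noncomputable def pseudoInverse (ψ : ℝ → ℝ) (x : ℝ) : ℝ≥0∞ :=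
  sInf {z | generatorExt ψ z = x}

/-- `C x = ψ (φ x₁ + ⋯ + φ x_d)` for some Archimedean generator `ψ` with pseudoinverse `φ`. -/
def Copula.IsArchimedean {d : ℕ} (C : Copula d) : Prop :=
  ∃ ψ : ℝ → ℝ, IsArchimedeanGenerator ψ ∧
    ∀ x : Fin d → I, C x = generatorExt ψ (∑ i, pseudoInverse ψ (x i))

/-- The probability measure `K (x, ·)` of a Markov kernel of `C`. -/
def Copula.IsMarkovKernelOf.probAt {d ℓ : ℕ} {C : Copula d} {h : ℓ ≤ d}
    {K : Kernel (Fin ℓ → I) (Fin (d - ℓ) → I)} (hK : C.IsMarkovKernelOf h K) (x : Fin ℓ → I) :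
    ProbabilityMeasure (Fin (d - ℓ) → I) :=
  ⟨K x, hK.isMarkovKernel.isProbabilityMeasure x⟩

/-! Write φ for the inverse of a generator ψ on (0,1] and G_k for (-1)^k times its k-th iterated
right derivative. Iterated decrements of ψ up to order d are masses of sets cut out by coordinate
intervals (`exists_box`), hence nonnegative. So on (0,∞) the functions G_k with k ≤ d-2 are
nonnegative, decreasing and convex, and G_{d-1} exists and is decreasing. Integrating back, the
ℓ-marginal has density ∏ G_1(φ(x_i))⁻¹ · G_ℓ(∑ φ(x_i)), and G_ℓ(∑ φ(x_i)) · K(x,[0,y]) = G_ℓ(∑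
φ(x_i) + ∑ φ(y_j)) for almost every x (`ae_density_mul_kernel`).

Rescaling the argument of a generator leaves the copula unchanged, so ψ(1) = 1/2 may be assumed.
Convergence of the copulas then forces pointwise convergence of the generators (`tendsto_generator`)
and of their inverses. For convex functions, pointwise convergence passes to right derivatives
wherever the limiting derivative is continuous (`tendsto_negRightDeriv`), and a monotone derivative
has only countably many discontinuities. For almost every x the arguments above avoid them for all y
in a countable dense grid, and the denominator is nonzero almost everywhere for the marginal. Hence
the kernels converge on the grid, and weak convergence follows by compactness of the space of
probability measures on the cube (`Cube.tendsto_of_tendsto_Iic`). -/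

/-! ### Multiply monotone functions and their right derivatives. -/

/-- The backward difference `t ↦ f t - f (t + h)`. -/
def decrement (h : ℝ) (f : ℝ → ℝ) : ℝ → ℝ := fun t => f t - f (t + h)

/-- Nonnegative, antitone and convex on `(0, ∞)`, as are all iterated decrements of order at
most `m`. -/
def IsMultiplyMonotone : ℕ → (ℝ → ℝ) → Prop
  | 0, f => (∀ t, 0 < t → 0 ≤ f t) ∧ AntitoneOn f (Ioi 0) ∧ ConvexOn ℝ (Ioi 0) f
  | m + 1, f => ((∀ t, 0 < t → 0 ≤ f t) ∧ AntitoneOn f (Ioi 0) ∧ ConvexOn ℝ (Ioi 0) f) ∧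
      ∀ h, 0 < h → IsMultiplyMonotone m (decrement h f)

/-- The negative of the right derivative. -/
noncomputable def negRightDeriv (f : ℝ → ℝ) : ℝ → ℝ := fun t => -derivWithin f (Ioi t) t

theorem measurable_negRightDeriv (f : ℝ → ℝ) : Measurable (negRightDeriv f) :=
  (measurable_derivWithin_Ioi f).neg

namespace IsMultiplyMonotone

theorem zero_of {m : ℕ} {f : ℝ → ℝ} (hf : IsMultiplyMonotone m f) : IsMultiplyMonotone 0 f := by
  cases m with
  | zero => exact hf
  | succ m => exact hf.1

theorem convexOn_of_tendsto {F : ℕ → ℝ → ℝ} {f : ℝ → ℝ}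
    (hF : ∀ n, ConvexOn ℝ (Ioi 0) (F n))
    (h : ∀ t, 0 < t → Tendsto (fun n => F n t) atTop (𝓝 (f t))) : ConvexOn ℝ (Ioi 0) f := by
  refine ⟨convex_Ioi 0, fun x hx y hy a b ha hb hab => ?_⟩
  have hxy : a • x + b • y ∈ Ioi (0 : ℝ) := convex_Ioi 0 hx hy ha hb hab
  exact le_of_tendsto_of_tendsto' (h _ hxy)
    (((h x hx).const_smul a).add ((h y hy).const_smul b)) fun n => (hF n).2 hx hy ha hb hab

/-- Every clause is a weak inequality between finitely many values, so it survives pointwise limits.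
-/
theorem of_tendsto {m : ℕ} : ∀ {F : ℕ → ℝ → ℝ} {f : ℝ → ℝ}, (∀ n, IsMultiplyMonotone m (F n)) →
    (∀ t, 0 < t → Tendsto (fun n => F n t) atTop (𝓝 (f t))) → IsMultiplyMonotone m f := by
  have base : ∀ {F : ℕ → ℝ → ℝ} {f : ℝ → ℝ}, (∀ n, IsMultiplyMonotone 0 (F n)) →
      (∀ t, 0 < t → Tendsto (fun n => F n t) atTop (𝓝 (f t))) → IsMultiplyMonotone 0 f := by
    intro F f hF h
    refine ⟨fun t ht => ge_of_tendsto' (h t ht) fun n => (hF n).1 t ht, ?_,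
      convexOn_of_tendsto (fun n => (hF n).2.2) h⟩
    intro s hs t ht hst
    exact le_of_tendsto_of_tendsto' (h t ht) (h s hs) fun n => (hF n).2.1 hs ht hst
  induction m with
  | zero => exact base
  | succ m ih =>
    intro F f hF h
    refine ⟨base (fun n => (hF n).1) h, fun k hk => ih (fun n => (hF n).2 k hk) fun t ht => ?_⟩
    exact (h t ht).sub (h (t + k) (by positivity))

theorem const_mul {m : ℕ} {c : ℝ} (hc : 0 ≤ c) :
    ∀ {f : ℝ → ℝ}, IsMultiplyMonotone m f → IsMultiplyMonotone m (fun t => c * f t) := by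
  have base : ∀ {f : ℝ → ℝ}, IsMultiplyMonotone 0 f → IsMultiplyMonotone 0 (fun t => c * f t) := by
    rintro f ⟨h0, h1, h2⟩
    refine ⟨fun t ht => mul_nonneg hc (h0 t ht),
      fun s hs t ht hst => mul_le_mul_of_nonneg_left (h1 hs ht hst) hc, ?_⟩
    simpa using h2.smul hc
  induction m with
  | zero => exact base
  | succ m ih =>
    intro f hf
    refine ⟨base hf.1, fun k hk => ?_⟩
    have := ih (hf.2 k hk)
    convert this using 2
    simp only [decrement]; ring

section base

variable {f : ℝ → ℝ} (hf : IsMultiplyMonotone 0 f)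
include hf

theorem hasDerivWithinAt {t : ℝ} (ht : 0 < t) :
    HasDerivWithinAt f (-negRightDeriv f t) (Ioi t) t := by
  have := hf.2.2.hasDerivWithinAt_rightDeriv_of_mem_interior (x := t) (by simpa using ht)
  simpa [negRightDeriv] using this

theorem antitoneOn_negRightDeriv : AntitoneOn (negRightDeriv f) (Ioi 0) := by
  have := hf.2.2.monotoneOn_rightDeriv
  rw [interior_Ioi] at this
  intro s hs t ht hst
  exact neg_le_neg (this hs ht hst)

theorem sub_le_mul_negRightDeriv {a b : ℝ} (ha : 0 < a) (hab : a < b) :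
    f a - f b ≤ (b - a) * negRightDeriv f a := by
  have h := hf.2.2.rightDeriv_le_slope_of_mem_interior (x := a) (y := b) (by simpa using ha)
    (ha.trans hab) hab
  rw [slope_def_field, le_div_iff₀ (sub_pos.2 hab)] at h
  simp only [negRightDeriv]
  linarith

/-- Slopes left of `b` lie below slopes right of `b`, hence below their limit. Together with
`sub_le_mul_negRightDeriv` this traps the derivative between difference quotients. -/
theorem mul_negRightDeriv_le_sub {a b : ℝ} (ha : 0 < a) (hab : a < b) :
    (b - a) * negRightDeriv f b ≤ f a - f b := by
  have hb : 0 < b := ha.trans hab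
  have h := hf.hasDerivWithinAt hb
  have hs : ∀ y, b < y → slope f a b ≤ slope f b y := fun y hy => by
    have := hf.2.2.slope_mono_adjacent ha (hb.trans hy) hab hy
    simpa [slope_def_field] using this
  have hlim : Tendsto (slope f b) (𝓝[>] b) (𝓝 (-negRightDeriv f b)) := by
    simpa using (hasDerivWithinAt_iff_tendsto_slope' (by simp)).1 h
  have h2 := ge_of_tendsto hlim (eventually_nhdsWithin_of_forall fun y hy => hs y hy)
  rw [slope_def_field, div_le_iff₀ (sub_pos.2 hab)] at h2
  linarith

theorem negRightDeriv_nonneg {t : ℝ} (ht : 0 < t) : 0 ≤ negRightDeriv f t := by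
  have h := hf.sub_le_mul_negRightDeriv ht (lt_add_one t)
  have h2 := hf.2.1 ht (show (0 : ℝ) < t + 1 by positivity) (by linarith)
  simp at h
  linarith

theorem tendsto_negRightDeriv_atTop (hlim : Tendsto f atTop (𝓝 0)) :
    Tendsto (negRightDeriv f) atTop (𝓝 0) := by
  have h1 : Tendsto (fun t => f (t - 1)) atTop (𝓝 0) :=
    hlim.comp (tendsto_atTop_add_const_right _ (-1) tendsto_id)
  refine tendsto_of_tendsto_of_tendsto_of_le_of_le' tendsto_const_nhds h1 ?_ ?_
  · filter_upwards [eventually_gt_atTop 0] with t ht using hf.negRightDeriv_nonneg ht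
  · filter_upwards [eventually_gt_atTop 1] with t ht
    have := hf.mul_negRightDeriv_le_sub (a := t - 1) (b := t) (by linarith) (by linarith)
    have h0 := hf.1 t (by linarith)
    simp at this
    linarith

/-- The fundamental theorem of calculus needs only a right derivative here: convexity makes `f`
continuous, and the monotone derivative is integrable on compact intervals. -/
theorem lintegral_negRightDeriv (hlim : Tendsto f atTop (𝓝 0)) {a : ℝ} (ha : 0 < a) :
    ∫⁻ t in Ioi a, ENNReal.ofReal (negRightDeriv f t) = ENNReal.ofReal (f a) := by
  have hcont : ContinuousOn f (Ioi 0) := hf.2.2.continuousOn isOpen_Ioi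
  have hint : ∀ b, a ≤ b → IntervalIntegrable (negRightDeriv f) volume a b := fun b hb => by
    refine AntitoneOn.intervalIntegrable fun s hs t ht hst => ?_
    rw [uIcc_of_le hb] at hs ht
    exact hf.antitoneOn_negRightDeriv (ha.trans_le hs.1) (ha.trans_le ht.1) hst
  have hftc : ∀ b, a ≤ b → ∫ t in a..b, negRightDeriv f t = f a - f b := fun b hb => by
    have := intervalIntegral.integral_eq_sub_of_hasDeriv_right_of_le (f := fun t => -f t)
      (f' := negRightDeriv f) hb
      (hcont.neg.mono fun x hx => ha.trans_le hx.1)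
      (fun x hx => ((hf.hasDerivWithinAt (ha.trans hx.1)).neg).congr_deriv (neg_neg _)) (hint b hb)
    rw [this]; ring
  have hI : IntegrableOn (negRightDeriv f) (Ioi a) := by
    refine integrableOn_Ioi_of_intervalIntegral_norm_tendsto (f a) a
      (fun b => ?_) tendsto_id (b := id) (l := atTop) ?_
    · rcases le_total a b with h | h
      · exact (intervalIntegrable_iff_integrableOn_Ioc_of_le h).1 (hint b h)
      · simp [Ioc_eq_empty (not_lt.2 h)]
    · have : Tendsto (fun b => f a - f b) atTop (𝓝 (f a - 0)) := tendsto_const_nhds.sub hlim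
      rw [sub_zero] at this
      refine this.congr' ?_
      filter_upwards [eventually_ge_atTop a] with b hb
      rw [← hftc b hb]
      refine intervalIntegral.integral_congr fun t ht => ?_
      rw [uIcc_of_le hb] at ht
      exact (Real.norm_of_nonneg (hf.negRightDeriv_nonneg (ha.trans_le ht.1))).symm
  rw [← ofReal_integral_eq_lintegral_ofReal hI]
  · congr 1
    have h1 := intervalIntegral_tendsto_integral_Ioi a hI tendsto_id
    have h2 : Tendsto (fun b => f a - f b) atTop (𝓝 (f a - 0)) := tendsto_const_nhds.sub hlim
    rw [sub_zero] at h2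
    refine tendsto_nhds_unique h1 (h2.congr' ?_)
    filter_upwards [eventually_ge_atTop a] with b hb
    exact (hftc b hb).symm
  · filter_upwards [ae_restrict_mem measurableSet_Ioi] with t ht
    exact hf.negRightDeriv_nonneg (ha.trans ht)

end base

/-- The right derivative is a pointwise limit of rescaled decrements, each of which is multiply
monotone of order `m` by definition. -/
theorem negRightDeriv {m : ℕ} {f : ℝ → ℝ} (hf : IsMultiplyMonotone (m + 1) f) :
    IsMultiplyMonotone m (negRightDeriv f) := by
  refine of_tendsto (F := fun n t => ((1 : ℝ) / (n + 1))⁻¹ * decrement (1 / (n + 1)) f t)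
    (fun n => (hf.2 (1 / ((n : ℝ) + 1)) Nat.one_div_pos_of_nat).const_mul (by positivity)) fun t ht => ?_
  have h := (hf.zero_of.hasDerivWithinAt ht).neg
  rw [neg_neg, hasDerivWithinAt_iff_tendsto_slope' (by simp)] at h
  have hl : Tendsto (fun n : ℕ => t + 1 / ((n : ℝ) + 1)) atTop (𝓝[>] t) := by
    refine tendsto_nhdsWithin_iff.2 ⟨?_, .of_forall fun n => ?_⟩
    · simpa using tendsto_one_div_add_atTop_nhds_zero_nat.const_add t
    · exact lt_add_of_pos_right t (Nat.one_div_pos_of_nat (n := n))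
  refine (h.comp hl).congr fun n => ?_
  simp only [Function.comp, slope_def_field, decrement, Pi.neg_apply]
  rw [add_sub_cancel_left, div_eq_inv_mul]
  ring

/-- Difference quotients on either side of `t` bound the derivatives of `F n`, and they converge to
those of `f`. The evaluation points `u n` may move because the inverse generators vary with `n`. -/
theorem tendsto_negRightDeriv {F : ℕ → ℝ → ℝ} {f : ℝ → ℝ} (hF : ∀ n, IsMultiplyMonotone 0 (F n))
    (hf : IsMultiplyMonotone 0 f)
    (h : ∀ t, 0 < t → Tendsto (fun n => F n t) atTop (𝓝 (f t)))
    {u : ℕ → ℝ} {t : ℝ} (ht : 0 < t) (hu : Tendsto u atTop (𝓝 t))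
    (hc : ContinuousAt (_root_.negRightDeriv f) t) :
    Tendsto (fun n => _root_.negRightDeriv (F n) (u n)) atTop (𝓝 (_root_.negRightDeriv f t)) := by
  set g := _root_.negRightDeriv f with hg
  rw [Metric.tendsto_atTop']
  suffices key : ∀ ε > 0, (∀ᶠ n in atTop, _root_.negRightDeriv (F n) (u n) < g t + ε) ∧
      ∀ᶠ n in atTop, g t - ε < _root_.negRightDeriv (F n) (u n) by
    intro ε hε
    obtain ⟨h1, h2⟩ := key ε hε
    obtain ⟨N, hN⟩ := eventually_atTop.1 (h1.and h2)
    refine ⟨N, fun n hn => ?_⟩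
    rw [Real.dist_eq, abs_lt]
    constructor <;> linarith [(hN n hn.le).1, (hN n hn.le).2]
  intro ε hε
  obtain ⟨δ, hδ, hδ'⟩ := Metric.continuousAt_iff.1 hc ε hε
  set r := min (δ / 2) (t / 2) with hr
  have hr0 : 0 < r := by positivity
  have hrδ : r < δ := (min_le_left _ _).trans_lt (by linarith)
  have hrt : r < t := (min_le_right _ _).trans_lt (by linarith)
  have hlo : g (t - r) < g t + ε := by
    have := hδ' (x := t - r) (by simp [abs_of_pos hr0, hrδ])
    rw [Real.dist_eq, abs_lt] at this
    linarith [this.2]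
  have hhi : g t - ε < g (t + r) := by
    have := hδ' (x := t + r) (by simp [abs_of_pos hr0, hrδ])
    rw [Real.dist_eq, abs_lt] at this
    linarith [this.1]
  constructor
  · have h1 : ∀ᶠ n in atTop, (F n (t - r) - F n (t - r / 2)) / (r / 2) < g t + ε := by
      refine Tendsto.eventually_lt_const ?_
        (((h (t - r) (by linarith)).sub (h (t - r / 2) (by linarith))).div_const (r / 2))
      have := hf.sub_le_mul_negRightDeriv (a := t - r) (b := t - r / 2) (by linarith) (by linarith)
      rw [div_lt_iff₀ (by positivity)]
      nlinarith
    filter_upwards [h1, hu.eventually_const_lt (show t - r / 2 < t by linarith)] with n hn hun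
    refine lt_of_le_of_lt ?_ hn
    have h2 := (hF n).mul_negRightDeriv_le_sub (a := t - r) (b := t - r / 2) (by linarith)
      (by linarith)
    have h3 := (hF n).antitoneOn_negRightDeriv (show (0 : ℝ) < t - r / 2 by linarith)
      (show (0 : ℝ) < u n by linarith) hun.le
    rw [le_div_iff₀ (by positivity)]
    nlinarith
  · have h1 : ∀ᶠ n in atTop, g t - ε < (F n (t + r / 2) - F n (t + r)) / (r / 2) := by
      refine Tendsto.eventually_const_lt ?_
        (((h (t + r / 2) (by linarith)).sub (h (t + r) (by linarith))).div_const (r / 2))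
      have := hf.mul_negRightDeriv_le_sub (a := t + r / 2) (b := t + r) (by linarith) (by linarith)
      rw [lt_div_iff₀ (by positivity)]
      nlinarith
    filter_upwards [h1, hu.eventually_lt_const (show t < t + r / 2 by linarith),
      hu.eventually_const_lt ht] with n hn hun hun0
    refine lt_of_lt_of_le hn ?_
    have h2 := (hF n).sub_le_mul_negRightDeriv (a := t + r / 2) (b := t + r) (by linarith)
      (by linarith)
    have h3 := (hF n).antitoneOn_negRightDeriv (show (0 : ℝ) < u n from hun0)
      (show (0 : ℝ) < t + r / 2 by linarith) hun.le
    rw [div_le_iff₀ (by positivity)]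
    nlinarith

theorem iterate_negRightDeriv {m : ℕ} : ∀ {k : ℕ} {f : ℝ → ℝ}, IsMultiplyMonotone (m + k) f →
    IsMultiplyMonotone m (_root_.negRightDeriv^[k] f)
  | 0, _, hf => hf
  | k + 1, f, hf => by
    rw [Function.iterate_succ_apply]
    exact iterate_negRightDeriv hf.negRightDeriv

theorem mono {m k : ℕ} (hk : k ≤ m) {f : ℝ → ℝ} (hf : IsMultiplyMonotone m f) :
    IsMultiplyMonotone k f := by
  induction m generalizing k f with
  | zero => simpa [Nat.le_zero.1 hk] using hf
  | succ m ih =>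
    cases k with
    | zero => exact hf.1
    | succ k => exact ⟨hf.1, fun h hh => ih (Nat.le_of_succ_le_succ hk) (hf.2 h hh)⟩

/-- Up to order `k` there are no exceptional points: each derivative of the limit is itself convex,
hence continuous. Only one order further can jumps occur. -/
theorem tendsto_iterate_negRightDeriv {F : ℕ → ℝ → ℝ} {f : ℝ → ℝ} {k : ℕ}
    (hF : ∀ n, IsMultiplyMonotone k (F n)) (hf : IsMultiplyMonotone k f)
    (h : ∀ t, 0 < t → Tendsto (fun n => F n t) atTop (𝓝 (f t)))
    {t : ℝ} (ht : 0 < t) :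
    Tendsto (fun n => _root_.negRightDeriv^[k] (F n) t) atTop
      (𝓝 (_root_.negRightDeriv^[k] f t)) := by
  induction k generalizing t with
  | zero => exact h t ht
  | succ k ih =>
    simp only [Function.iterate_succ_apply']
    refine tendsto_negRightDeriv (fun n => iterate_negRightDeriv (m := 0)
      ((hF n).mono (by omega))) (iterate_negRightDeriv (m := 0) (hf.mono (by omega)))
      (fun t ht => ih (fun n => (hF n).mono (by omega)) (hf.mono (by omega)) ht) ht
      tendsto_const_nhds ?_
    rw [← Function.iterate_succ_apply' _root_.negRightDeriv]
    exact ((iterate_negRightDeriv (m := 0) (hf.mono (by omega))).2.2.continuousOn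
      isOpen_Ioi).continuousAt (Ioi_mem_nhds ht)

/-- A continuous function whose decrements are antitone is convex. -/
theorem _root_.convexOn_of_continuous_of_decrement_antitone {f : ℝ → ℝ} (hf : Continuous f)
    (h : ∀ k, 0 < k → AntitoneOn (decrement k f) (Ioi 0)) : ConvexOn ℝ (Ioi 0) f := by
  have hd : ∀ k x : ℝ, HasDerivAt (fun x => ∫ y in x..x + k, f y) (f (x + k) - f x) x := by
    intro k x
    have h1 : ∀ c : ℝ, HasDerivAt (fun x => ∫ y in (0 : ℝ)..x, f y) (f c) c := fun c =>
      intervalIntegral.integral_hasDerivAt_right (hf.intervalIntegrable _ _)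
        (hf.stronglyMeasurableAtFilter _ _) hf.continuousAt
    refine (((h1 (x + k)).comp_add_const x k).sub (h1 x)).congr_of_eventuallyEq
      (.of_forall fun z => ?_)
    exact (intervalIntegral.integral_interval_sub_left (hf.intervalIntegrable _ _)
      (hf.intervalIntegrable _ _)).symm
  -- Moving averages of `f` are differentiable with derivative a positive multiple of minus a
  -- decrement, so they are convex; they converge to `f` as the window shrinks.
  refine convexOn_of_tendsto
    (F := fun n x => ((1 : ℝ) / (n + 1))⁻¹ * ∫ y in x..x + 1 / (n + 1), f y) (fun n => ?_) ?_
  · have hk : (0 : ℝ) < 1 / (n + 1) := Nat.one_div_pos_of_nat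
    have hc : ConvexOn ℝ (Ioi 0) fun x => ∫ y in x..x + 1 / ((n : ℝ) + 1), f y := by
      refine MonotoneOn.convexOn_of_deriv (convex_Ioi 0)
        (fun x _ => (hd _ x).continuousAt.continuousWithinAt)
        (fun x _ => (hd _ x).differentiableAt.differentiableWithinAt) ?_
      rw [interior_Ioi]
      intro s hs t ht hst
      rw [(hd _ s).deriv, (hd _ t).deriv]
      have := h _ hk hs ht hst
      simp only [decrement] at this
      linarith
    simpa using hc.smul (inv_nonneg.2 hk.le)
  · intro t _
    have h1 : HasDerivAt (fun x => ∫ y in t..x, f y) (f t) t :=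
      intervalIntegral.integral_hasDerivAt_right (hf.intervalIntegrable _ _)
        (hf.stronglyMeasurableAtFilter _ _) hf.continuousAt
    have h2 := (hasDerivWithinAt_iff_tendsto_slope' (s := Ioi t) (by simp)).1
      h1.hasDerivWithinAt
    have hl : Tendsto (fun n : ℕ => t + 1 / ((n : ℝ) + 1)) atTop (𝓝[>] t) := by
      refine tendsto_nhdsWithin_iff.2 ⟨?_, .of_forall fun n => ?_⟩
      · simpa using tendsto_one_div_add_atTop_nhds_zero_nat.const_add t
      · exact lt_add_of_pos_right t (Nat.one_div_pos_of_nat (n := n))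
    refine (h2.comp hl).congr fun n => ?_
    simp only [Function.comp, slope_def_field, intervalIntegral.integral_same, sub_zero]
    rw [add_sub_cancel_left, div_eq_inv_mul]

end IsMultiplyMonotone

/-! ### Distribution functions and weak convergence on the cube. -/

namespace Cube

theorem ext_of_Iic {n : ℕ} {μ ν : Measure (Fin n → I)} [IsFiniteMeasure μ]
    (h : ∀ x : Fin n → I, μ (Iic x) = ν (Iic x)) : μ = ν := by
  have hgen : (inferInstance : MeasurableSpace (Fin n → I)) =
      MeasurableSpace.generateFrom (pi univ '' pi univ fun _ : Fin n => range (Iic : I → Set I)) := by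
    refine (generateFrom_eq_pi (fun _ => ?_) fun _ => ?_).symm
    · rw [← borel_eq_generateFrom_Iic, BorelSpace.measurable_eq (α := I)]
    · exact ⟨fun _ => Iic 1, fun _ => mem_range_self _, by
        rw [iUnion_const]
        exact Set.eq_univ_of_forall fun x => unitInterval.le_one'⟩
  have huniv : (Iic (fun _ => 1) : Set (Fin n → I)) = univ :=
    Set.eq_univ_of_forall fun x i => unitInterval.le_one'
  refine ext_of_generate_finite _ hgen (IsPiSystem.pi fun _ => ?_) ?_ ?_
  · rintro _ ⟨a, rfl⟩ _ ⟨b, rfl⟩ _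
    exact ⟨a ⊓ b, Iic_inter_Iic.symm⟩
  · rintro _ ⟨s, hs, rfl⟩
    choose x hx using fun i => hs i (mem_univ i)
    have : (univ : Set (Fin n)).pi s = Iic x := by
      rw [← pi_univ_Iic]
      exact pi_congr rfl fun i _ => (hx i).symm
    rw [this, h]
  · rw [← huniv, h]

/-- Every point of the interval is a limit from the right, in a weak sense, of points of a dense
set that contains `1`. -/
theorem exists_seq_tendsto_of_dense {Q : Set I} (hQ : Dense Q) (h1 : (1 : I) ∈ Q) (y : I) :
    ∃ q : ℕ → I, Antitone q ∧ (∀ k, q k ∈ Q) ∧ (∀ k, y < q k ∨ q k = 1) ∧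
      Tendsto q atTop (𝓝 y) := by
  rcases eq_or_lt_of_le (unitInterval.le_one' (t := y)) with rfl | hy
  · exact ⟨fun _ => 1, antitone_const, fun _ => h1, fun _ => .inr rfl, tendsto_const_nhds⟩
  · obtain ⟨q, hq, hq', hlim⟩ := hQ.exists_seq_strictAnti_tendsto_of_lt hy
    exact ⟨q, hq.antitone, fun k => (hq' k).2, fun k => .inl (hq' k).1.1, hlim⟩

/-- The alternative `y i < q k i ∨ q k i = 1` lets a relatively open box fit between `Iic y` and
`Iic (q k)`: where `q k i = 1`, the whole interval serves as the open factor. -/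
theorem exists_seq_tendsto_pi_of_dense {n : ℕ} {Q : Set I} (hQ : Dense Q) (h1 : (1 : I) ∈ Q)
    (y : Fin n → I) :
    ∃ q : ℕ → Fin n → I, Antitone q ∧ (∀ k i, q k i ∈ Q) ∧ (∀ k i, y i < q k i ∨ q k i = 1) ∧
      ⋂ k, Iic (q k) = Iic y := by
  choose q hq hQq hlt hlim using fun i => exists_seq_tendsto_of_dense hQ h1 (y i)
  refine ⟨fun k i => q i k, fun a b hab i => hq i hab, fun k i => hQq i k, fun k i => hlt i k, ?_⟩
  refine Subset.antisymm (fun x hx i => ?_) (subset_iInter fun k x hx i => ?_)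
  · exact ge_of_tendsto' (hlim i) fun k => mem_iInter.1 hx k i
  · rcases hlt i k with h | h
    · exact (hx i).trans h.le
    · exact unitInterval.le_one'.trans_eq h.symm

theorem tendsto_measure_Iic {n : ℕ} (μ : Measure (Fin n → I)) [IsFiniteMeasure μ]
    {q : ℕ → Fin n → I} (hq : Antitone q) {y : Fin n → I} (h : ⋂ k, Iic (q k) = Iic y) :
    Tendsto (fun k => μ (Iic (q k))) atTop (𝓝 (μ (Iic y))) := by
  rw [← h]
  exact tendsto_measure_iInter_atTop (fun k => measurableSet_Iic.nullMeasurableSet)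
    (fun a b hab => Iic_subset_Iic.2 (hq hab)) ⟨0, measure_ne_top _ _⟩

theorem ext_of_Iic_dense {n : ℕ} {μ ν : Measure (Fin n → I)} [IsFiniteMeasure μ]
    [IsFiniteMeasure ν] {Q : Set I} (hQ : Dense Q) (h1 : (1 : I) ∈ Q)
    (h : ∀ x : Fin n → I, (∀ i, x i ∈ Q) → μ (Iic x) = ν (Iic x)) : μ = ν := by
  refine ext_of_Iic fun y => ?_
  obtain ⟨q, hq, hqQ, -, hi⟩ := exists_seq_tendsto_pi_of_dense hQ h1 y
  refine tendsto_nhds_unique (tendsto_measure_Iic μ hq hi) ?_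
  simpa only [h _ (hqQ _)] using tendsto_measure_Iic ν hq hi

/-- Convergence of the distribution functions on a dense grid implies weak convergence. -/
theorem tendsto_of_tendsto_Iic {n : ℕ} {P : ℕ → ProbabilityMeasure (Fin n → I)}
    {P' : ProbabilityMeasure (Fin n → I)} {Q : Set I} (hQ : Dense Q) (h1 : (1 : I) ∈ Q)
    (h : ∀ x : Fin n → I, (∀ i, x i ∈ Q) →
      Tendsto (fun k => (P k : Measure (Fin n → I)) (Iic x)) atTop
        (𝓝 ((P' : Measure (Fin n → I)) (Iic x)))) :
    Tendsto P atTop (𝓝 P') := by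
  -- By compactness every ultrafilter has a limit `R`; the portmanteau inequalities for closed and
  -- open boxes identify `R` with `P'`.
  rw [tendsto_iff_ultrafilter]
  intro g hg
  obtain ⟨R, -, hR⟩ := isCompact_univ.ultrafilter_le_nhds (g.map P) (by simp)
  have hR : Tendsto P g (𝓝 R) := hR
  suffices R = P' by rwa [this] at hR
  have : IsProbabilityMeasure (R : Measure (Fin n → I)) := R.2
  have : IsProbabilityMeasure (P' : Measure (Fin n → I)) := P'.2
  refine Subtype.ext (ext_of_Iic (μ := (R : Measure (Fin n → I))) fun y => ?_)
  obtain ⟨q, hq, hqQ, hlt, hi⟩ := exists_seq_tendsto_pi_of_dense hQ h1 y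
  have hup : ∀ k, (P' : Measure (Fin n → I)) (Iic (q k)) ≤ (R : Measure (Fin n → I)) (Iic (q k)) :=
    fun k => by
    rw [← ((h _ (hqQ k)).mono_left hg).limsup_eq]
    exact ProbabilityMeasure.limsup_measure_closed_le_of_tendsto hR isClosed_Iic
  have hlo : ∀ k, (R : Measure (Fin n → I)) (Iic y) ≤ (P' : Measure (Fin n → I)) (Iic (q k)) :=
    fun k => by
    set O : Set (Fin n → I) := pi univ fun i => if q k i = 1 then univ else Iio (q k i) with hO
    have hOo : IsOpen O := isOpen_set_pi finite_univ fun i _ => by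
      split_ifs
      exacts [isOpen_univ, isOpen_Iio]
    have hyO : Iic y ⊆ O := fun x hx i _ => by
      dsimp only
      split_ifs with hi
      · trivial
      · exact (hx i).trans_lt ((hlt k i).resolve_right hi)
    have hOq : O ⊆ Iic (q k) := fun x hx i => by
      have := hx i (mem_univ i)
      dsimp only at this
      split_ifs at this with hi
      · exact hi ▸ unitInterval.le_one'
      · exact le_of_lt this
    rw [← ((h _ (hqQ k)).mono_left hg).liminf_eq]
    refine (measure_mono hyO).trans
      ((ProbabilityMeasure.le_liminf_measure_open_of_tendsto hR hOo).trans ?_)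
    exact liminf_le_liminf (.of_forall fun k => measure_mono hOq)
  refine le_antisymm (ge_of_tendsto' (tendsto_measure_Iic (P' : Measure (Fin n → I)) hq hi) hlo) ?_
  exact le_of_tendsto_of_tendsto' (tendsto_measure_Iic (P' : Measure (Fin n → I)) hq hi)
    (tendsto_measure_Iic (R : Measure (Fin n → I)) hq hi) hup

end Cube

/-! ### Generators and their normalization. -/

namespace IsArchimedeanGenerator

variable {ψ : ℝ → ℝ}

theorem lt_of_lt (hψ : IsArchimedeanGenerator ψ) {a b : ℝ} (ha : 0 ≤ a) (hab : a < b)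
    (hpos : 0 < ψ a) : ψ b < ψ a := by
  have hset : ∀ w, 0 ≤ w → ψ w = 0 → a ≤ w := fun w hw h0 => by
    by_contra! h
    exact hpos.not_ge (h0 ▸ hψ.antitoneOn hw ha h.le)
  by_cases hb : ∀ w, 0 ≤ w → ψ w = 0 → b ≤ w
  · exact hψ.strictAntiOn ⟨ha, hset⟩ ⟨ha.trans hab.le, hb⟩ hab
  · push Not at hb
    obtain ⟨w, hw, h0, hwb⟩ := hb
    exact (h0 ▸ hψ.antitoneOn hw (ha.trans hab.le) hwb.le).trans_lt hpos

theorem pseudoInverse_apply (hψ : IsArchimedeanGenerator ψ) {w : ℝ} (hw : 0 ≤ w)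
    (hpos : 0 < ψ w) : pseudoInverse ψ (ψ w) = ENNReal.ofReal w := by
  have : {z | generatorExt ψ z = ψ w} = {ENNReal.ofReal w} := by
    ext v
    simp only [generatorExt, mem_ofPred_eq, mem_singleton_iff]
    constructor
    · intro h
      split_ifs at h with hv
      · exact absurd h hpos.ne
      · rw [← ENNReal.ofReal_toReal hv]
        congr 1
        rcases lt_trichotomy v.toReal w with h1 | h1 | h1
        · exact absurd h (hψ.lt_of_lt ENNReal.toReal_nonneg h1 (h ▸ hpos)).ne'
        · exact h1
        · exact absurd h (hψ.lt_of_lt hw h1 hpos).ne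
    · rintro rfl
      simp [ENNReal.toReal_ofReal hw]
  rw [pseudoInverse, this, sInf_singleton]

theorem exists_eq_half (hψ : IsArchimedeanGenerator ψ) : ∃ c, 0 < c ∧ ψ c = 1 / 2 := by
  obtain ⟨b, hb, hb0⟩ := ((hψ.tendsto_atTop.eventually_lt_const
    (show (0 : ℝ) < 1 / 2 by norm_num)).and (eventually_ge_atTop 0)).exists
  obtain ⟨c, hc, hc'⟩ := intermediate_value_Icc' hb0 (hψ.continuousOn.mono fun x hx => hx.1)
    ⟨hb.le, by rw [hψ.map_zero]; norm_num⟩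
  refine ⟨c, hc.1.lt_of_ne ?_, hc'⟩
  rintro rfl
  rw [hψ.map_zero] at hc'
  norm_num at hc'

end IsArchimedeanGenerator

/-- A generator `ψ` of the copula `C`, extended to a continuous antitone function on the line and
scaled such that `ψ 1 = 1 / 2`. -/
structure IsNormalizedGenerator {d : ℕ} (C : Copula d) (ψ : ℝ → ℝ) : Prop where
  continuous : Continuous ψ
  antitone : Antitone ψ
  map_zero : ψ 0 = 1
  map_one : ψ 1 = 1 / 2
  tendsto_atTop : Tendsto ψ atTop (𝓝 0)
  lt_of_lt : ∀ a b, 0 ≤ a → a < b → 0 < ψ a → ψ b < ψ a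
  measureReal_box : ∀ z : Fin d → ℝ, (∀ i, 0 ≤ z i) →
    C.measure.real {x | ∀ i, (x i : ℝ) ≤ ψ (z i)} = ψ (∑ i, z i)

theorem Copula.measure_le_zero {d : ℕ} (C : Copula d) (i : Fin d) :
    C.measure {x | x i ≤ 0} = 0 := by
  have h := congrArg (fun μ => μ (Iic (0 : I))) (C.map_eval i)
  simp only [Measure.map_apply (measurable_pi_apply i) measurableSet_Iic] at h
  have h' : C.measure {x | x i ≤ 0} = volume (Iic (0 : I)) := h
  rw [h', unitInterval.volume_Iic]
  simp

theorem Copula.IsArchimedean.exists_isNormalizedGenerator {d : ℕ} {C : Copula d}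
    (hC : C.IsArchimedean) : ∃ ψ, IsNormalizedGenerator C ψ := by
  obtain ⟨ψ, hψ, h⟩ := hC
  obtain ⟨c, hc, hc2⟩ := hψ.exists_eq_half
  have hmem : ∀ z, 0 ≤ c * max z 0 := fun z => by positivity
  -- The factor `c`, with `ψ c = 1 / 2`, fixes the scale; `max z 0` makes the function constant on
  -- the negative half-line.
  refine ⟨fun z => ψ (c * max z 0), ?_, ?_, by simp [hψ.map_zero], by simp [hc2], ?_, ?_, ?_⟩
  · exact hψ.continuousOn.comp_continuous (by fun_prop) hmem
  · intro a b hab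
    exact hψ.antitoneOn (hmem a) (hmem b) (by gcongr)
  · refine hψ.tendsto_atTop.comp (Tendsto.const_mul_atTop hc ?_)
    exact tendsto_atTop_mono (fun z => le_max_left z 0) tendsto_id
  · intro a b ha hab hpos
    refine hψ.lt_of_lt (hmem a) ?_ hpos
    rw [max_eq_left ha, max_eq_left (ha.trans hab.le)]
    gcongr
  · intro z hz
    have hw : ∀ i, c * max (z i) 0 = c * z i := fun i => by rw [max_eq_left (hz i)]
    have hw0 : ∀ i, 0 ≤ c * z i := fun i => mul_nonneg hc.le (hz i)
    have hs0 : 0 ≤ ∑ i, z i := Finset.sum_nonneg fun i _ => hz i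
    simp only [hw, max_eq_left hs0]
    have hbox : {x : Fin d → I | ∀ i, (x i : ℝ) ≤ ψ (c * z i)} =
        Iic fun i => (⟨ψ (c * z i), hψ.mem_Icc _ (hw0 i)⟩ : I) := rfl
    by_cases hpos : ∀ i, 0 < ψ (c * z i)
    · rw [hbox]
      refine (h _).trans ?_
      simp only [hψ.pseudoInverse_apply (hw0 _) (hpos _)]
      rw [← ENNReal.ofReal_sum_of_nonneg fun i _ => hw0 i, ← Finset.mul_sum]
      simp [generatorExt, ENNReal.toReal_ofReal (mul_nonneg hc.le hs0)]
    -- At a zero value of `ψ` the pseudoinverse need not return the chosen argument, but then both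
    -- sides vanish.
    · push Not at hpos
      obtain ⟨i, hi⟩ := hpos
      have h0 : ψ (c * ∑ i, z i) = 0 := by
        refine le_antisymm (le_trans ?_ hi) (hψ.mem_Icc _ (mul_nonneg hc.le hs0)).1
        refine hψ.antitoneOn (hw0 i) (mul_nonneg hc.le hs0) ?_
        exact mul_le_mul_of_nonneg_left
          (Finset.single_le_sum (fun j _ => hz j) (Finset.mem_univ i)) hc.le
      rw [h0, measureReal_eq_zero_iff]
      exact measure_mono_null (fun x hx => (hx i).trans hi) (C.measure_le_zero i)

/-! ### Multiple monotonicity of a generator. -/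

namespace IsNormalizedGenerator

variable {d : ℕ} {C : Copula d} {ψ : ℝ → ℝ} (hψ : IsNormalizedGenerator C ψ)
include hψ

theorem nonneg (z : ℝ) : 0 ≤ ψ z := hψ.antitone.le_of_tendsto hψ.tendsto_atTop z

theorem le_one {z : ℝ} (hz : 0 ≤ z) : ψ z ≤ 1 := hψ.map_zero ▸ hψ.antitone hz

/-- Each decrement by `h` uses a fresh coordinate `k`: raising `z k` by `h` shrinks the box, and the
difference keeps the points with `ψ (z k + h) < x k ≤ ψ (z k)`. This is why at most `d` decrements
are allowed. The constraint `B z` sees only coordinates already used, so the shift leaves it alone.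
-/
theorem exists_box : ∀ L : List ℝ, (∀ h ∈ L, 0 < h) → L.length ≤ d →
    ∃ B : (Fin d → ℝ) → Set (Fin d → I), (∀ z, MeasurableSet (B z)) ∧
      (∀ z z', (∀ i : Fin d, (i : ℕ) < L.length → z i = z' i) → B z = B z') ∧
      ∀ z, (∀ i, 0 ≤ z i) → L.foldr decrement ψ (∑ i, z i) =
        C.measure.real (B z ∩ {x | ∀ i, (x i : ℝ) ≤ ψ (z i)})
  | [], _, _ => ⟨fun _ => univ, fun _ => .univ, fun _ _ _ => rfl, fun z hz => by
      rw [univ_inter, hψ.measureReal_box z hz, List.foldr_nil]⟩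
  | h :: L, hL, hd => by
    obtain ⟨B, hBm, hB, hBψ⟩ := exists_box L (fun k hk => hL k (List.mem_cons_of_mem _ hk))
      (by rw [List.length_cons] at hd; omega)
    have hh : 0 < h := hL h List.mem_cons_self
    let k : Fin d := ⟨L.length, by rw [List.length_cons] at hd; omega⟩
    refine ⟨fun z => B z ∩ {x | ψ (z k + h) < x k}, fun z => (hBm z).inter ?_, ?_, ?_⟩
    · exact measurableSet_lt measurable_const
        (measurable_subtype_coe.comp (measurable_pi_apply k))
    · intro z z' hz
      dsimp only
      rw [hB z z' fun i hi => hz i (hi.trans (by simp)), hz k (by simp [k])]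
    · intro z hz
      have hs : ∑ i, (z + Pi.single k h : Fin d → ℝ) i = ∑ i, z i + h := by
        simp [Finset.sum_add_distrib]
      have hz' : ∀ i, 0 ≤ (z + Pi.single k h : Fin d → ℝ) i := fun i =>
        add_nonneg (hz i) ((Pi.single_nonneg.2 hh.le : (0 : Fin d → ℝ) ≤ Pi.single k h) i)
      have hBz : B (z + Pi.single k h) = B z := hB _ _ fun i hi => by
        have : i ≠ k := fun h => by subst h; exact lt_irrefl _ hi
        simp [this]
      have hsub : B z ∩ {x | ∀ i, (x i : ℝ) ≤ ψ ((z + Pi.single k h : Fin d → ℝ) i)} ⊆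
          B z ∩ {x | ∀ i, (x i : ℝ) ≤ ψ (z i)} := by
        refine inter_subset_inter_right _ fun x hx i => (hx i).trans (hψ.antitone ?_)
        exact le_add_of_nonneg_right ((Pi.single_nonneg.2 hh.le : (0 : Fin d → ℝ) ≤ _) i)
      have hmeas : MeasurableSet {x : Fin d → I | ∀ i, (x i : ℝ) ≤ ψ ((z + Pi.single k h : Fin d → ℝ) i)} := by
        simp only [ofPred_forall]
        exact MeasurableSet.iInter fun i => measurableSet_le
          (measurable_subtype_coe.comp (measurable_pi_apply i)) measurable_const
      rw [List.foldr_cons, decrement, ← hs, hBψ z hz, hBψ _ hz', hBz,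
        ← measureReal_sdiff hsub ((hBm z).inter hmeas)]
      congr 1
      ext x
      simp only [Set.mem_sdiff, mem_inter_iff, mem_ofPred_eq, not_and, not_forall, not_le]
      constructor
      · rintro ⟨⟨h1, h2⟩, h3⟩
        obtain ⟨i, hi⟩ := h3 h1
        have : i = k := by
          by_contra hik
          exact absurd (h2 i) (by simpa [hik] using hi)
        subst this
        exact ⟨⟨h1, by simpa using hi⟩, h2⟩
      · rintro ⟨⟨h1, h2⟩, h3⟩
        exact ⟨⟨h1, h3⟩, fun _ => ⟨k, by simpa using h2⟩⟩

theorem foldr_decrement_nonneg (hd : 0 < d) {L : List ℝ} (hL : ∀ h ∈ L, 0 < h)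
    (hLd : L.length ≤ d) {t : ℝ} (ht : 0 ≤ t) : 0 ≤ L.foldr decrement ψ t := by
  obtain ⟨B, -, -, hB⟩ := hψ.exists_box L hL hLd
  have := hB (Pi.single ⟨0, hd⟩ t) fun i =>
    (Pi.single_nonneg.2 ht : (0 : Fin d → ℝ) ≤ Pi.single ⟨0, hd⟩ t) i
  simp only [Finset.sum_pi_single', Finset.mem_univ, if_true] at this
  rw [this]
  exact measureReal_nonneg

theorem continuous_foldr_decrement : ∀ L : List ℝ, Continuous (L.foldr decrement ψ)
  | [] => hψ.continuous
  | h :: L => by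
    have := continuous_foldr_decrement L
    rw [List.foldr_cons]
    exact this.sub (this.comp (continuous_add_const h))

/-- Nonnegativity of one further decrement gives monotonicity and of two gives convexity, which
accounts for the `2` in the budget `d`. -/
theorem isMultiplyMonotone_foldr_decrement {m : ℕ} : ∀ {L : List ℝ}, (∀ h ∈ L, 0 < h) →
    L.length + m + 2 ≤ d → IsMultiplyMonotone m (L.foldr decrement ψ) := by
  have base : ∀ {L : List ℝ}, (∀ h ∈ L, 0 < h) → L.length + 2 ≤ d →
      IsMultiplyMonotone 0 (L.foldr decrement ψ) := by
    intro L hL hLd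
    have hcons : ∀ {L : List ℝ} {h : ℝ}, (∀ k ∈ L, 0 < k) → 0 < h → ∀ k ∈ h :: L, 0 < k := by
      intro L h hL hh k hk
      rcases List.mem_cons.1 hk with rfl | hk
      exacts [hh, hL k hk]
    have hanti : ∀ {L : List ℝ}, (∀ h ∈ L, 0 < h) → L.length + 1 ≤ d →
        AntitoneOn (L.foldr decrement ψ) (Ioi 0) := by
      intro L hL hLd s hs t _ hst
      rcases hst.eq_or_lt with rfl | hst
      · rfl
      · have := hψ.foldr_decrement_nonneg (by omega) (hcons hL (sub_pos.2 hst))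
          (by simpa using hLd) (le_of_lt hs)
        simpa [decrement] using this
    refine ⟨fun t ht => hψ.foldr_decrement_nonneg (by omega) hL (by omega) ht.le,
      hanti hL (by omega), convexOn_of_continuous_of_decrement_antitone
        (hψ.continuous_foldr_decrement L) fun k hk => ?_⟩
    exact hanti (L := k :: L) (hcons hL hk) (by simp only [List.length_cons]; omega)
  induction m with
  | zero => exact base
  | succ m ih =>
    intro L hL hLd
    refine ⟨base hL (by omega), fun h hh => ih (L := h :: L) (fun k hk => ?_) ?_⟩
    · rcases List.mem_cons.1 hk with rfl | hk
      exacts [hh, hL k hk]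
    · simp only [List.length_cons]; omega

theorem isMultiplyMonotone {m : ℕ} (hm : m + 2 ≤ d) : IsMultiplyMonotone m ψ :=
  hψ.isMultiplyMonotone_foldr_decrement (L := []) (by simp) (by simpa using hm)

end IsNormalizedGenerator

/-! ### The inverse generator. -/

/-- The inverse of a generator on `(0, 1]`, extended by zero. -/
noncomputable def generatorInv (ψ : ℝ → ℝ) (x : ℝ) : ℝ :=
  open scoped Classical in if 0 < x then sInf {z | 0 ≤ z ∧ ψ z ≤ x} else 0

theorem generatorInv_nonneg (ψ : ℝ → ℝ) (x : ℝ) : 0 ≤ generatorInv ψ x := by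
  unfold generatorInv
  split_ifs
  · exact Real.sInf_nonneg fun z hz => hz.1
  · exact le_rfl

namespace IsNormalizedGenerator

variable {d : ℕ} {C : Copula d} {ψ : ℝ → ℝ} (hψ : IsNormalizedGenerator C ψ)
include hψ

/-- By continuity of `ψ` the infimum is attained. -/
theorem generatorInv_le_iff {x z : ℝ} (hx : 0 < x) (hz : 0 ≤ z) :
    generatorInv ψ x ≤ z ↔ ψ z ≤ x := by
  rw [generatorInv, if_pos hx]
  have hbdd : BddBelow {z | 0 ≤ z ∧ ψ z ≤ x} := ⟨0, fun _ h => h.1⟩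
  refine ⟨fun h => ?_, fun h => csInf_le hbdd ⟨hz, h⟩⟩
  have hne : {z | 0 ≤ z ∧ ψ z ≤ x}.Nonempty := by
    obtain ⟨b, hb, hb0⟩ := ((hψ.tendsto_atTop.eventually_lt_const hx).and
      (eventually_ge_atTop 0)).exists
    exact ⟨b, hb0, hb.le⟩
  have hcl : IsClosed {z | 0 ≤ z ∧ ψ z ≤ x} :=
    isClosed_Ici.inter (isClosed_Iic.preimage hψ.continuous)
  exact (hψ.antitone h).trans (hcl.csInf_mem hne hbdd).2

theorem apply_generatorInv {x : ℝ} (hx : 0 < x) (hx1 : x ≤ 1) : ψ (generatorInv ψ x) = x := by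
  have h0 := generatorInv_nonneg ψ x
  have hle := (hψ.generatorInv_le_iff hx h0).1 le_rfl
  obtain ⟨z, hz, hzx⟩ := intermediate_value_Icc' h0 hψ.continuous.continuousOn
    ⟨hle, hψ.map_zero.symm ▸ hx1⟩
  have := (hψ.generatorInv_le_iff hx hz.1).2 hzx.le
  rw [le_antisymm this hz.2, hzx]

theorem le_generatorInv_iff {x z : ℝ} (hx : 0 < x) (hx1 : x ≤ 1) :
    z ≤ generatorInv ψ x ↔ x ≤ ψ z := by
  refine ⟨fun h => (hψ.apply_generatorInv hx hx1).symm.trans_le (hψ.antitone h), fun h => ?_⟩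
  by_contra! hlt
  have := hψ.lt_of_lt _ _ (generatorInv_nonneg ψ x) hlt (by rwa [hψ.apply_generatorInv hx hx1])
  rw [hψ.apply_generatorInv hx hx1] at this
  exact this.not_ge h

theorem generatorInv_one : generatorInv ψ 1 = 0 :=
  le_antisymm ((hψ.generatorInv_le_iff one_pos le_rfl).2 hψ.map_zero.le) (generatorInv_nonneg ψ 1)

theorem measurable_generatorInv : Measurable (generatorInv ψ) := by
  refine measurable_of_Iic fun z => ?_
  rcases lt_or_ge z 0 with hz | hz
  · convert MeasurableSet.empty
    exact eq_empty_of_forall_notMem fun x hx => (hz.trans_le (generatorInv_nonneg ψ x)).not_ge hx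
  · have : generatorInv ψ ⁻¹' Iic z = Iic 0 ∪ (Ioi 0 ∩ Ici (ψ z)) := by
      ext x
      rcases le_or_gt x 0 with hx | hx
      · simp [generatorInv, hx.not_gt, hx, hz]
      · simp [hψ.generatorInv_le_iff hx hz, hx, hx.not_ge]
    rw [this]
    exact measurableSet_Iic.union (measurableSet_Ioi.inter measurableSet_Ici)

end IsNormalizedGenerator

/-! ### Lipschitz continuity of copulas. -/

namespace Copula

/-- A point of `[0, x]` outside `[0, y]` has some coordinate in `(y i, x i]`, an event whose mass is
known from the uniform marginals. -/
theorem sub_le_sum_abs {d : ℕ} (C : Copula d) (x y : Fin d → I) :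
    C x - C y ≤ ∑ i, |(x i : ℝ) - y i| := by
  have hsub : Iic x ⊆ Iic y ∪ ⋃ i, (fun u : Fin d → I => u i) ⁻¹' Ioc (y i) (x i) := by
    intro u hu
    by_cases h : u ≤ y
    · exact .inl h
    · obtain ⟨i, hi⟩ := not_forall.1 h
      exact .inr (mem_iUnion.2 ⟨i, not_le.1 hi, hu i⟩)
  have h1 : C x ≤ C y + ∑ i, C.measure.real ((fun u : Fin d → I => u i) ⁻¹' Ioc (y i) (x i)) :=
    (measureReal_mono hsub).trans ((measureReal_union_le _ _).trans
      (add_le_add_right (measureReal_iUnion_fintype_le _) _))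
  have h2 : ∀ i, C.measure.real ((fun u : Fin d → I => u i) ⁻¹' Ioc (y i) (x i)) ≤
      |(x i : ℝ) - y i| := fun i => by
    have h := congrArg (fun μ => μ (Ioc (y i) (x i))) (C.map_eval i)
    simp only [Measure.map_apply (measurable_pi_apply i) measurableSet_Ioc,
      unitInterval.volume_Ioc] at h
    rw [measureReal_def, h, ENNReal.toReal_ofReal']
    exact max_le (le_abs_self _) (abs_nonneg _)
  linarith [Finset.sum_le_sum fun i (_ : i ∈ Finset.univ) => h2 i]

theorem continuous_apply {d : ℕ} (C : Copula d) : Continuous fun x => C x := by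
  refine continuous_iff_continuousAt.2 fun x => tendsto_iff_dist_tendsto_zero.2 ?_
  have hlim : Tendsto (fun y : Fin d → I => ∑ i, |(y i : ℝ) - x i|) (𝓝 x) (𝓝 0) := by
    have : Continuous fun y : Fin d → I => ∑ i, |(y i : ℝ) - x i| := by fun_prop
    simpa using this.tendsto x
  refine squeeze_zero (fun _ => dist_nonneg) (fun y => ?_) hlim
  rw [Real.dist_eq, abs_le]
  have h1 := C.sub_le_sum_abs x y
  have h2 := C.sub_le_sum_abs y x
  simp only [abs_sub_comm (x _ : ℝ)] at h1
  constructor <;> linarith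

end Copula

/-! ### Convergence of generators and of their inverses. -/

section convergence

variable {d : ℕ} {C : Copula d} {Cn : ℕ → Copula d} {ψ : ℝ → ℝ} {ψn : ℕ → ℝ → ℝ}
  (hconv : TendstoUniformly (fun (n : ℕ) (x : Fin d → I) => Cn n x) (fun x => C x) atTop)
  (hψ : IsNormalizedGenerator C ψ) (hψn : ∀ n, IsNormalizedGenerator (Cn n) (ψn n))
include hconv hψ hψn

theorem tendsto_generator_sum {z : Fin d → ℝ} (hz : ∀ i, 0 ≤ z i)
    (h : ∀ i, Tendsto (fun n => ψn n (z i)) atTop (𝓝 (ψ (z i)))) :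
    Tendsto (fun n => ψn n (∑ i, z i)) atTop (𝓝 (ψ (∑ i, z i))) := by
  let x : Fin d → I := fun i => ⟨ψ (z i), hψ.nonneg _, hψ.le_one (hz i)⟩
  let xn : ℕ → Fin d → I := fun n i => ⟨ψn n (z i), (hψn n).nonneg _, (hψn n).le_one (hz i)⟩
  have hx : Tendsto xn atTop (𝓝 x) :=
    tendsto_pi_nhds.2 fun i => tendsto_subtype_rng.2 (h i)
  have := hconv.tendsto_comp C.continuous_apply.continuousAt hx
  rw [← hψ.measureReal_box z hz]
  refine this.congr fun n => ?_
  rw [← (hψn n).measureReal_box z hz]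
  rfl

theorem tendsto_generator_add (hd : 2 ≤ d) {s t : ℝ} (hs : 0 ≤ s) (ht : 0 ≤ t)
    (h : Tendsto (fun n => ψn n s) atTop (𝓝 (ψ s)))
    (h' : Tendsto (fun n => ψn n t) atTop (𝓝 (ψ t))) :
    Tendsto (fun n => ψn n (s + t)) atTop (𝓝 (ψ (s + t))) := by
  let i : Fin d := ⟨0, by omega⟩
  let j : Fin d := ⟨1, by omega⟩
  have hij : i ≠ j := by simp [i, j]
  let z : Fin d → ℝ := Pi.single i s + Pi.single j t
  have hval : ∀ k, z k = s ∨ z k = t ∨ z k = 0 := fun k => by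
    by_cases h1 : k = i
    · subst h1; simp [z, hij]
    · by_cases h2 : k = j
      · subst h2; simp [z, hij.symm]
      · simp [z, h1, h2]
  have hsum : ∑ k, z k = s + t := by simp [z, Finset.sum_add_distrib]
  rw [← hsum]
  refine tendsto_generator_sum hconv hψ hψn (fun k => ?_) fun k => ?_
  · rcases hval k with h | h | h <;> rw [h]
    exacts [hs, ht]
  · rcases hval k with h1 | h1 | h1 <;> rw [h1]
    · exact h
    · exact h'
    · simp [hψ.map_zero, (hψn _).map_zero]

/-- On the diagonal `D` of a bivariate marginal, `D (ψ r) = ψ (2r)`. Since `ψ` is strictly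
decreasing near `2t`, comparing `D (ψn t)` with `D (ψ r)` for fixed `r` on either side of `t`
locates `ψn t`. -/
theorem tendsto_generator_half (hd : 2 ≤ d) {t : ℝ} (ht : 0 < t) (hpos : 0 < ψ (t + t))
    (h : Tendsto (fun n => ψn n (t + t)) atTop (𝓝 (ψ (t + t)))) :
    Tendsto (fun n => ψn n t) atTop (𝓝 (ψ t)) := by
  let i : Fin d := ⟨0, by omega⟩
  let j : Fin d := ⟨1, by omega⟩
  have hij : i ≠ j := by simp [i, j]
  let D : Copula d → ℝ → ℝ := fun C a => C.measure.real {x | (x i : ℝ) ≤ a ∧ (x j : ℝ) ≤ a}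
  have hD : ∀ {C : Copula d} {ψ : ℝ → ℝ}, IsNormalizedGenerator C ψ → ∀ {r}, 0 ≤ r →
      D C (ψ r) = ψ (r + r) := by
    intro C ψ hψ r hr
    let z : Fin d → ℝ := Pi.single i r + Pi.single j r
    have hsum : ∑ k, z k = r + r := by simp [z, Finset.sum_add_distrib]
    have hi : z i = r := by simp [z, hij]
    have hj : z j = r := by simp [z, hij.symm]
    have hk : ∀ k, k ≠ i → k ≠ j → z k = 0 := fun k h1 h2 => by simp [z, h1, h2]
    rw [← hsum, ← hψ.measureReal_box z fun k => ?_]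
    · refine congrArg C.measure.real (Set.ext fun x => ?_)
      refine ⟨fun hx k => ?_, fun hx => ⟨hi ▸ hx i, hj ▸ hx j⟩⟩
      by_cases h1 : k = i
      · subst h1; rw [hi]; exact hx.1
      · by_cases h2 : k = j
        · subst h2; rw [hj]; exact hx.2
        · rw [hk k h1 h2, hψ.map_zero]; exact (x k).2.2
    · by_cases h1 : k = i
      · rw [h1, hi]; exact hr
      · by_cases h2 : k = j
        · rw [h2, hj]; exact hr
        · rw [hk k h1 h2]
  have hmono : ∀ (C : Copula d), Monotone (D C) := fun C a b hab =>
    measureReal_mono fun x hx => ⟨hx.1.trans hab, hx.2.trans hab⟩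
  have hDconv : ∀ {r}, 0 ≤ r → Tendsto (fun n => D (Cn n) (ψ r)) atTop (𝓝 (D C (ψ r))) := by
    intro r hr
    let x : Fin d → I := fun k => if k = i ∨ k = j then ⟨ψ r, hψ.nonneg _, hψ.le_one hr⟩ else 1
    have hx : ∀ C, D C (ψ r) = C.measure.real (Iic x) := fun C => by
      refine congrArg C.measure.real (Set.ext fun u => ?_)
      constructor
      · intro hu k
        by_cases hk : k = i ∨ k = j
        · simp only [x, if_pos hk]
          rcases hk with rfl | rfl
          exacts [hu.1, hu.2]
        · simp only [x, if_neg hk]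
          exact unitInterval.le_one'
      · intro hu
        have h1 := hu i
        have h2 := hu j
        simp only [x, true_or, or_true, if_true] at h1 h2
        exact ⟨h1, h2⟩
    simp only [hx]
    exact hconv.tendsto_at x
  have hlim : Tendsto (fun n => D (Cn n) (ψn n t)) atTop (𝓝 (ψ (t + t))) := by
    simpa only [hD (hψn _) ht.le] using h
  refine tendsto_order.2 ⟨fun a ha => ?_, fun a ha => ?_⟩
  · obtain ⟨r, hr, hr'⟩ := ((hψ.continuous.tendsto t).mono_left nhdsWithin_le_nhds
      |>.eventually_const_lt ha |>.and (self_mem_nhdsWithin (s := Ioi t))).exists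
    have hr'' : t < r := hr'
    have hlt : D C (ψ r) < ψ (t + t) := by
      rw [hD hψ (ht.trans hr'').le]
      exact hψ.lt_of_lt _ _ (by positivity) (by linarith) hpos
    filter_upwards [(hDconv (ht.trans hr'').le).eventually_lt hlim hlt] with n hn
    exact hr.trans ((hmono _).reflect_lt hn)
  · obtain ⟨r, ⟨hr, hr0⟩, hr'⟩ := ((hψ.continuous.tendsto t).mono_left nhdsWithin_le_nhds
      |>.eventually_lt_const ha |>.and ((eventually_gt_nhds ht).filter_mono nhdsWithin_le_nhds)
      |>.and (self_mem_nhdsWithin (s := Iio t))).exists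
    have hr'' : r < t := hr'
    have hlt : ψ (t + t) < D C (ψ r) := by
      rw [hD hψ hr0.le]
      exact hψ.lt_of_lt _ _ (by positivity) (by linarith)
        (hpos.trans_le (hψ.antitone (by linarith)))
    filter_upwards [hlim.eventually_lt (hDconv hr0.le) hlt] with n hn
    exact ((hmono _).reflect_lt hn).trans hr

/-- The normalization gives convergence at 1, halving extends it to powers of 1/2, addition to
dyadic rationals, and monotonicity with continuity of `ψ` to all `t ≥ 0`. -/
theorem tendsto_generator (hd : 2 ≤ d) {t : ℝ} (ht : 0 ≤ t) :
    Tendsto (fun n => ψn n t) atTop (𝓝 (ψ t)) := by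
  have hpow : ∀ k : ℕ, Tendsto (fun n => ψn n ((1 / 2) ^ k)) atTop (𝓝 (ψ ((1 / 2) ^ k))) := by
    intro k
    induction k with
    | zero => simp [hψ.map_one, (hψn _).map_one]
    | succ k ih =>
      have hk : ((1 : ℝ) / 2) ^ (k + 1) + (1 / 2) ^ (k + 1) = (1 / 2) ^ k := by ring
      refine tendsto_generator_half hconv hψ hψn hd (by positivity) ?_ (by simpa only [hk] using ih)
      rw [hk]
      have : ψ 1 ≤ ψ ((1 / 2) ^ k) := hψ.antitone (pow_le_one₀ (by norm_num) (by norm_num))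
      rw [hψ.map_one] at this
      linarith
  have hdy : ∀ k m : ℕ,
      Tendsto (fun n => ψn n (m * (1 / 2) ^ k)) atTop (𝓝 (ψ (m * (1 / 2) ^ k))) := by
    intro k m
    induction m with
    | zero => simp [hψ.map_zero, (hψn _).map_zero]
    | succ m ih =>
      have := tendsto_generator_add hconv hψ hψn hd (by positivity) (by positivity) ih (hpow k)
      simpa only [Nat.cast_succ, add_mul, one_mul] using this
  have hnear : ∀ U ∈ 𝓝 t, ∃ k m : ℕ, (m * (1 / 2) ^ k : ℝ) ≤ t ∧ t ≤ (m + 1 : ℕ) * (1 / 2) ^ k ∧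
      (m * (1 / 2) ^ k : ℝ) ∈ U ∧ ((m + 1 : ℕ) * (1 / 2) ^ k : ℝ) ∈ U := by
    intro U hU
    obtain ⟨δ, hδ, hU⟩ := Metric.mem_nhds_iff.1 hU
    obtain ⟨k, hk⟩ := exists_pow_lt_of_lt_one hδ (show (1 / 2 : ℝ) < 1 by norm_num)
    have hk0 : (0 : ℝ) < (1 / 2) ^ k := by positivity
    have h1 := Nat.floor_le (show 0 ≤ t / (1 / 2) ^ k by positivity)
    have h2 := Nat.lt_floor_add_one (t / (1 / 2 : ℝ) ^ k)
    rw [le_div_iff₀ hk0] at h1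
    rw [div_lt_iff₀ hk0] at h2
    refine ⟨k, ⌊t / (1 / 2) ^ k⌋₊, h1, by push_cast; exact h2.le, hU ?_, hU ?_⟩ <;>
    · rw [Metric.mem_ball, Real.dist_eq, abs_lt]
      push_cast
      constructor <;> linarith
  refine tendsto_order.2 ⟨fun a ha => ?_, fun a ha => ?_⟩
  · obtain ⟨k, m, -, h1, -, h2⟩ := hnear _ (hψ.continuous.continuousAt.eventually_const_lt ha)
    filter_upwards [(hdy k (m + 1)).eventually_const_lt h2] with n hn
    exact hn.trans_le ((hψn n).antitone h1)
  · obtain ⟨k, m, h1, -, h2, -⟩ := hnear _ (hψ.continuous.continuousAt.eventually_lt_const ha)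
    filter_upwards [(hdy k m).eventually_lt_const h2] with n hn
    exact ((hψn n).antitone h1).trans_lt hn

theorem tendsto_generatorInv (hd : 2 ≤ d) {x : ℝ} (hx : 0 < x) (hx1 : x ≤ 1) :
    Tendsto (fun n => generatorInv (ψn n) x) atTop (𝓝 (generatorInv ψ x)) := by
  have h0 := generatorInv_nonneg ψ x
  refine tendsto_order.2 ⟨fun a ha => ?_, fun a ha => ?_⟩
  · rcases lt_or_ge a 0 with ha0 | ha0
    · exact .of_forall fun n => ha0.trans_le (generatorInv_nonneg _ _)
    · have : x < ψ a := not_le.1 fun h => ha.not_ge ((hψ.generatorInv_le_iff hx ha0).2 h)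
      filter_upwards [(tendsto_generator hconv hψ hψn hd ha0).eventually_const_lt this] with n hn
      exact not_le.1 fun h => hn.not_ge (((hψn n).generatorInv_le_iff hx ha0).1 h)
  · set b := (a + generatorInv ψ x) / 2 with hb
    have hb1 : generatorInv ψ x < b := by linarith
    have : ψ b < x := by
      have := hψ.lt_of_lt _ _ h0 hb1 (by rwa [hψ.apply_generatorInv hx hx1])
      rwa [hψ.apply_generatorInv hx hx1] at this
    filter_upwards [(tendsto_generator hconv hψ hψn hd
      (h0.trans hb1.le)).eventually_lt_const this] with n hn
    exact (((hψn n).generatorInv_le_iff hx (h0.trans hb1.le)).2 hn.le).trans_lt (by linarith)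

end convergence

/-! ### Tail integrals and the change of variables by the inverse generator. -/

/-- The tail integral `a ↦ ∫_a^∞ G`. -/
noncomputable def tailIntegral (G : ℝ → ℝ≥0∞) (a : ℝ) : ℝ≥0∞ := ∫⁻ t in Ioi a, G t

theorem antitone_tailIntegral (G : ℝ → ℝ≥0∞) : Antitone (tailIntegral G) :=
  fun _ _ h => lintegral_mono_set (Ioi_subset_Ioi h)

theorem measurable_tailIntegral (G : ℝ → ℝ≥0∞) : Measurable (tailIntegral G) :=
  (antitone_tailIntegral G).measurable

theorem tailIntegral_congr {G H : ℝ → ℝ≥0∞} (h : EqOn G H (Ioi 0)) {a : ℝ} (ha : 0 ≤ a) :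
    tailIntegral G a = tailIntegral H a :=
  setLIntegral_congr_fun measurableSet_Ioi fun _ ht => h (ha.trans_lt ht)

theorem iterate_tailIntegral_congr {G H : ℝ → ℝ≥0∞} (h : EqOn G H (Ioi 0)) :
    ∀ k : ℕ, EqOn (tailIntegral^[k] G) (tailIntegral^[k] H) (Ioi 0)
  | 0 => h
  | k + 1 => fun a ha => by
    simp only [Function.iterate_succ_apply']
    exact tailIntegral_congr (iterate_tailIntegral_congr h k) (le_of_lt ha)

theorem tendsto_tailIntegral_zero (G : ℝ → ℝ≥0∞) :
    Tendsto (fun n : ℕ => tailIntegral G (1 / ((n : ℝ) + 1))) atTop (𝓝 (tailIntegral G 0)) := by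
  have hU : ⋃ n : ℕ, Ioi (1 / ((n : ℝ) + 1)) = Ioi 0 := by
    ext x
    simp only [mem_iUnion, mem_Ioi]
    exact ⟨fun ⟨n, hn⟩ => Nat.one_div_pos_of_nat.trans hn, fun hx => exists_nat_one_div_lt hx⟩
  have hG : ∀ a, tailIntegral G a = (volume.withDensity G) (Ioi a) := fun a =>
    (withDensity_apply _ measurableSet_Ioi).symm
  simp only [hG]
  rw [← hU]
  refine tendsto_measure_iUnion_atTop fun a b hab => Ioi_subset_Ioi ?_
  exact Nat.one_div_le_one_div hab

/-- The `k`-th derivative of a generator up to sign, as a density. -/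
noncomputable def generatorDensity (ψ : ℝ → ℝ) (k : ℕ) (t : ℝ) : ℝ≥0∞ :=
  ENNReal.ofReal (negRightDeriv^[k] ψ t)

/-- The reciprocal of the density of the inverse image of a uniform variable. -/
noncomputable def generatorWeight (ψ : ℝ → ℝ) (u : I) : ℝ≥0∞ :=
  (generatorDensity ψ 1 (generatorInv ψ u))⁻¹

theorem measurable_generatorDensity (ψ : ℝ → ℝ) (k : ℕ) :
    Measurable (generatorDensity ψ (k + 1)) := by
  unfold generatorDensity
  simp only [Function.iterate_succ_apply']
  exact (measurable_negRightDeriv _).ennreal_ofReal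

theorem ae_unitInterval_mem_Ioo : ∀ᵐ u : I, 0 < u ∧ u < 1 := by
  have h0 : ∀ᵐ u : I, u ≠ 0 := by simp [ae_iff]
  have h1 : ∀ᵐ u : I, u ≠ 1 := by simp [ae_iff]
  filter_upwards [h0, h1] with u hu0 hu1
  exact ⟨unitInterval.pos_iff_ne_zero.2 hu0, unitInterval.lt_one_iff_ne_one.2 hu1⟩

theorem ae_cube_mem_Ioo (ℓ : ℕ) : ∀ᵐ x : Fin ℓ → I, ∀ i, 0 < x i ∧ x i < 1 :=
  ae_all_iff.2 fun i => (Measure.tendsto_eval_ae_ae (μ := fun _ : Fin ℓ => (volume : Measure I))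
    (i := i)).eventually ae_unitInterval_mem_Ioo

namespace IsNormalizedGenerator

variable {d : ℕ} {C : Copula d} {ψ : ℝ → ℝ} (hψ : IsNormalizedGenerator C ψ)
include hψ

theorem tendsto_iterate_negRightDeriv_atTop {k : ℕ} (hk : k + 1 ≤ d) :
    Tendsto (negRightDeriv^[k] ψ) atTop (𝓝 0) := by
  induction k with
  | zero => exact hψ.tendsto_atTop
  | succ k ih =>
    rw [Function.iterate_succ_apply']
    refine IsMultiplyMonotone.tendsto_negRightDeriv_atTop ?_ (ih (by omega))
    exact IsMultiplyMonotone.iterate_negRightDeriv (hψ.isMultiplyMonotone (by omega))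

theorem tailIntegral_generatorDensity {k : ℕ} (hk : k + 2 ≤ d) {a : ℝ} (ha : 0 < a) :
    tailIntegral (generatorDensity ψ (k + 1)) a = generatorDensity ψ k a := by
  unfold tailIntegral generatorDensity
  simp only [Function.iterate_succ_apply']
  refine IsMultiplyMonotone.lintegral_negRightDeriv ?_
    (hψ.tendsto_iterate_negRightDeriv_atTop (by omega)) ha
  exact IsMultiplyMonotone.iterate_negRightDeriv (hψ.isMultiplyMonotone (by omega))

theorem tailIntegral_generatorDensity_one (hd : 2 ≤ d) {a : ℝ} (ha : 0 ≤ a) :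
    tailIntegral (generatorDensity ψ 1) a = ENNReal.ofReal (ψ a) := by
  rcases ha.eq_or_lt with rfl | ha
  · refine tendsto_nhds_unique (tendsto_tailIntegral_zero _) ?_
    have h1 : Tendsto (fun n : ℕ => ψ (1 / ((n : ℝ) + 1))) atTop (𝓝 (ψ 0)) :=
      (hψ.continuous.tendsto 0).comp tendsto_one_div_add_atTop_nhds_zero_nat
    refine (ENNReal.tendsto_ofReal h1).congr fun n => ?_
    exact (hψ.tailIntegral_generatorDensity hd Nat.one_div_pos_of_nat).symm
  · exact hψ.tailIntegral_generatorDensity hd ha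

theorem iterate_tailIntegral_generatorDensity {j k : ℕ} (h : j + k + 1 ≤ d) :
    EqOn (tailIntegral^[k] (generatorDensity ψ (j + k))) (generatorDensity ψ j) (Ioi 0) := by
  induction k with
  | zero => exact fun _ _ => rfl
  | succ k ih =>
    intro a ha
    rw [Function.iterate_succ_apply, ← ih (by omega) ha]
    exact iterate_tailIntegral_congr (G := tailIntegral (generatorDensity ψ (j + k + 1)))
      (fun t ht => hψ.tailIntegral_generatorDensity (by omega) ht) k ha

/-- The point `a = 0` is allowed even if derivatives blow up there: the outermost integral uses
values on (0,∞) only, and `ψ` is continuous at 0. -/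
theorem iterate_tailIntegral_eq {ℓ : ℕ} (hℓ : 1 ≤ ℓ) (hℓd : ℓ + 1 ≤ d) {a : ℝ} (ha : 0 ≤ a) :
    tailIntegral^[ℓ] (generatorDensity ψ ℓ) a = ENNReal.ofReal (ψ a) := by
  obtain ⟨k, rfl⟩ := Nat.exists_eq_add_of_le hℓ
  rw [← hψ.tailIntegral_generatorDensity_one (by omega) ha, Nat.add_comm 1 k,
    Function.iterate_succ_apply', Nat.add_comm k 1]
  exact tailIntegral_congr (hψ.iterate_tailIntegral_generatorDensity (by omega)) ha

theorem generatorDensity_one_ne_zero (hd : 2 ≤ d) {t : ℝ} (ht : 0 < t) (hpos : 0 < ψ t) :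
    generatorDensity ψ 1 t ≠ 0 := by
  intro h0
  have hanti := (hψ.isMultiplyMonotone (m := 0) hd).antitoneOn_negRightDeriv
  have h1 : tailIntegral (generatorDensity ψ 1) t = 0 := by
    refine (setLIntegral_congr_fun (g := fun _ => 0) measurableSet_Ioi fun s hs => ?_).trans
      (by simp)
    have hs' : t < s := hs
    simp only [generatorDensity, Function.iterate_one, ENNReal.ofReal_eq_zero] at h0 ⊢
    exact (hanti ht (ht.trans hs') hs'.le).trans h0
  rw [hψ.tailIntegral_generatorDensity_one hd ht.le, ENNReal.ofReal_eq_zero] at h1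
  exact h1.not_gt hpos

/-- The weight is `∞` where the first density vanishes and cannot be cancelled there; this makes the
integrand it multiplies zero as well. -/
theorem generatorDensity_eq_zero (hd : 2 ≤ d) {s : ℝ} (hs : 0 < s)
    (h : generatorDensity ψ 1 s = 0) (k : ℕ) : ∀ t, s ≤ t → generatorDensity ψ (k + 1) t = 0 := by
  suffices ∀ t, s ≤ t → negRightDeriv^[k + 1] ψ t = 0 by
    intro t ht
    rw [generatorDensity, this t ht, ENNReal.ofReal_zero]
  have h0 := hψ.isMultiplyMonotone (m := 0) hd
  induction k with
  | zero =>
    intro t ht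
    simp only [generatorDensity, Function.iterate_one, ENNReal.ofReal_eq_zero, zero_add] at h ⊢
    exact le_antisymm ((h0.antitoneOn_negRightDeriv hs (hs.trans_le ht) ht).trans h)
      (h0.negRightDeriv_nonneg (hs.trans_le ht))
  | succ k ih =>
    intro t ht
    have hz : EqOn (negRightDeriv^[k + 1] ψ) (fun _ => 0) (Ioi t) := fun x hx =>
      ih x (ht.trans (le_of_lt hx))
    rw [Function.iterate_succ_apply', negRightDeriv, derivWithin_congr hz (ih t ht)]
    simp

theorem measurable_generatorInv_coe : Measurable fun u : I => generatorInv ψ u :=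
  hψ.measurable_generatorInv.comp measurable_subtype_coe

theorem measurable_generatorWeight : Measurable (generatorWeight ψ) :=
  ((measurable_generatorDensity ψ 0).comp hψ.measurable_generatorInv_coe).inv

/-- The generalised inverse maps the uniform distribution to the one with survival function `ψ`. -/
theorem map_generatorInv (hd : 2 ≤ d) :
    (volume : Measure I).map (fun u : I => generatorInv ψ u) =
      (volume.restrict (Ioi 0)).withDensity (generatorDensity ψ 1) := by
  have : IsFiniteMeasure ((volume : Measure I).map fun u : I => generatorInv ψ u) :=
    Measure.isFiniteMeasure_map _ _
  refine Measure.ext_of_Ici _ _ fun z => ?_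
  rw [Measure.map_apply hψ.measurable_generatorInv_coe measurableSet_Ici,
    withDensity_apply _ measurableSet_Ici, Measure.restrict_restrict measurableSet_Ici]
  rcases le_or_gt z 0 with hz | hz
  · rw [inter_eq_right.2 (Ioi_subset_Ici hz)]
    have h1 : (fun u : I => generatorInv ψ u) ⁻¹' Ici z = univ :=
      eq_univ_of_forall fun u => hz.trans (generatorInv_nonneg ψ u)
    have h2 := hψ.tailIntegral_generatorDensity_one hd le_rfl
    rw [tailIntegral] at h2
    rw [h1, h2, hψ.map_zero]
    simp
  · rw [inter_eq_left.2 (Ici_subset_Ioi.2 hz), ← setLIntegral_congr Ioi_ae_eq_Ici]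
    have h2 := hψ.tailIntegral_generatorDensity_one hd hz.le
    rw [tailIntegral] at h2
    have h1 : (fun u : I => generatorInv ψ u) ⁻¹' Ici z =
        Ioc 0 ⟨ψ z, hψ.nonneg z, hψ.le_one hz.le⟩ := by
      ext u
      rcases eq_or_ne u 0 with rfl | hu
      · simp [generatorInv, hz]
      · have hu : 0 < u := unitInterval.pos_iff_ne_zero.2 hu
        simp only [mem_preimage, mem_Ici, mem_Ioc, hu, true_and]
        exact hψ.le_generatorInv_iff hu u.2.2
    rw [h1, h2, unitInterval.volume_Ioc]
    simp

theorem preimage_Ici_ae_eq {x : I} (hx : 0 < x) :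
    (fun u : I => generatorInv ψ u) ⁻¹' Ici (generatorInv ψ x) =ᵐ[volume] Iic x := by
  filter_upwards [ae_unitInterval_mem_Ioo] with u hu
  refine propext ?_
  change generatorInv ψ x ≤ generatorInv ψ u ↔ u ≤ x
  rw [hψ.le_generatorInv_iff hu.1 u.2.2, hψ.apply_generatorInv hx x.2.2]
  rfl

/-- Substituting `t = generatorInv ψ u` produces the first density, which the weight cancels; a
translation by `c` remains. `hH0` covers the points where this density is zero. -/
theorem setLIntegral_generatorWeight (hd : 2 ≤ d) {H : ℝ → ℝ≥0∞} (hH : Measurable H)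
    (hH0 : ∀ s t, 0 < s → s ≤ t → generatorDensity ψ 1 s = 0 → H t = 0)
    {x : I} (hx : 0 < x) {c : ℝ} (hc : 0 ≤ c) :
    ∫⁻ u in Iic x, generatorWeight ψ u * H (generatorInv ψ u + c) =
      tailIntegral H (generatorInv ψ x + c) := by
  have hx0 := generatorInv_nonneg ψ x
  have hD := measurable_generatorDensity ψ 0
  have hm : Measurable fun t => (generatorDensity ψ 1 t)⁻¹ * H (t + c) :=
    hD.inv.mul (hH.comp (measurable_add_const c))
  rw [← setLIntegral_congr (hψ.preimage_Ici_ae_eq hx)]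
  have h1 := setLIntegral_map (μ := volume) (measurableSet_Ici (a := generatorInv ψ x)) hm
    hψ.measurable_generatorInv_coe
  refine h1.symm.trans ?_
  rw [hψ.map_generatorInv hd,
    setLIntegral_withDensity_eq_setLIntegral_mul _ hD hm measurableSet_Ici,
    ← setLIntegral_congr (s := Ioi (generatorInv ψ x)) (ae_restrict_of_ae Ioi_ae_eq_Ici),
    Measure.restrict_restrict measurableSet_Ioi, inter_eq_left.2 (Ioi_subset_Ioi hx0)]
  have h2 : ∫⁻ t in Ioi (generatorInv ψ x), H (t + c) = tailIntegral H (generatorInv ψ x + c) := by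
    rw [tailIntegral, ← lintegral_indicator measurableSet_Ioi,
      ← lintegral_indicator measurableSet_Ioi,
      ← lintegral_add_right_eq_self ((Ioi (generatorInv ψ x + c)).indicator H) c]
    exact lintegral_congr fun t => by simp [indicator]
  rw [← h2]
  refine setLIntegral_congr_fun measurableSet_Ioi fun t ht => ?_
  have ht0 : 0 < t := hx0.trans_lt ht
  by_cases h0 : generatorDensity ψ 1 t = 0
  · simp [hH0 t (t + c) ht0 (by linarith) h0]
  · simp only [Pi.mul_apply]
    rw [← mul_assoc, ENNReal.mul_inv_cancel h0 ENNReal.ofReal_ne_top, one_mul]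

/-- By Tonelli, integrating out one coordinate replaces `H` by its tail integral and moves that
coordinate's inverse value into `c`. -/
theorem setLIntegral_prod_generatorWeight (hd : 2 ≤ d) {ℓ : ℕ} :
    ∀ {H : ℝ → ℝ≥0∞}, Measurable H →
      (∀ s t, 0 < s → s ≤ t → generatorDensity ψ 1 s = 0 → H t = 0) →
      ∀ {x : Fin ℓ → I}, (∀ i, 0 < x i) → ∀ {c : ℝ}, 0 ≤ c →
      ∫⁻ u in Iic x, (∏ i, generatorWeight ψ (u i)) * H (∑ i, generatorInv ψ (u i) + c) =
        tailIntegral^[ℓ] H (∑ i, generatorInv ψ (x i) + c) := by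
  have hw := hψ.measurable_generatorWeight
  have hφ := hψ.measurable_generatorInv_coe
  induction ℓ with
  | zero =>
    intro H hH hH0 x hx c hc
    have : (Iic x : Set (Fin 0 → I)) = univ := eq_univ_of_forall fun u i => i.elim0
    rw [this]
    simp [lintegral_unique, Measure.volume_pi_eq_dirac (Classical.arbitrary (Fin 0 → I))]
  | succ ℓ ih =>
    intro H hH hH0 x hx c hc
    let e := MeasurableEquiv.piFinSuccAbove (fun _ : Fin (ℓ + 1) => I) 0
    have he : MeasurePreserving e volume volume := volume_preserving_piFinSuccAbove _ 0
    let x' : Fin ℓ → I := fun j => x (Fin.succAbove 0 j)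
    let g : I × (Fin ℓ → I) → ℝ≥0∞ := fun p =>
      (∏ i, generatorWeight ψ (p.2 i)) *
        (generatorWeight ψ p.1 * H (generatorInv ψ p.1 + (∑ i, generatorInv ψ (p.2 i) + c)))
    have hg : Measurable g := by
      refine Measurable.mul ?_ (Measurable.mul (hw.comp measurable_fst) (hH.comp ?_))
      · exact Finset.measurable_prod _ fun i _ =>
          hw.comp ((measurable_pi_apply i).comp measurable_snd)
      · refine (hφ.comp measurable_fst).add (Measurable.add_const ?_ c)
        exact Finset.measurable_sum _ fun i _ =>
          hφ.comp ((measurable_pi_apply i).comp measurable_snd)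
    have hpre : e ⁻¹' (Iic (x 0) ×ˢ Iic x') = Iic x := by
      ext u
      refine ⟨fun h i => ?_, fun h => ⟨h 0, fun j => h _⟩⟩
      refine Fin.cases h.1 (fun j => ?_) i
      exact h.2 j
    calc ∫⁻ u in Iic x, (∏ i, generatorWeight ψ (u i)) * H (∑ i, generatorInv ψ (u i) + c)
        = ∫⁻ u in e ⁻¹' (Iic (x 0) ×ˢ Iic x'), g (e u) := by
          rw [hpre]
          refine lintegral_congr fun u => ?_
          rw [Fin.prod_univ_succAbove _ 0, Fin.sum_univ_succAbove _ 0, add_assoc,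
            mul_comm (generatorWeight ψ (u 0)), mul_assoc]
          rfl
      _ = ∫⁻ p in Iic (x 0) ×ˢ Iic x', g p := he.setLIntegral_comp_preimage
          (measurableSet_Iic.prod measurableSet_Iic) hg
      _ = ∫⁻ v in Iic x', ∫⁻ a in Iic (x 0), g (a, v) := by
          rw [Measure.volume_eq_prod, ← Measure.prod_restrict]
          exact lintegral_prod_symm _ hg.aemeasurable
      _ = ∫⁻ v in Iic x', (∏ i, generatorWeight ψ (v i)) *
            tailIntegral H (∑ i, generatorInv ψ (v i) + (generatorInv ψ (x 0) + c)) := by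
          refine lintegral_congr fun v => ?_
          have hs : 0 ≤ ∑ i, generatorInv ψ (v i) :=
            Finset.sum_nonneg fun i _ => generatorInv_nonneg _ _
          have hm : Measurable fun a : I => generatorWeight ψ a *
              H (generatorInv ψ a + (∑ i, generatorInv ψ (v i) + c)) :=
            hw.mul (hH.comp (hφ.add_const _))
          simp only [g]
          rw [lintegral_const_mul _ hm,
            hψ.setLIntegral_generatorWeight hd hH hH0 (hx 0) (add_nonneg hs hc)]
          congr 2
          ring
      _ = tailIntegral^[ℓ] (tailIntegral H)
            (∑ i, generatorInv ψ (x' i) + (generatorInv ψ (x 0) + c)) := by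
          refine ih (measurable_tailIntegral H) (fun s t hs hst h0 => ?_) (fun i => hx _)
            (add_nonneg (generatorInv_nonneg _ _) hc)
          refine (setLIntegral_congr_fun (g := fun _ => 0) measurableSet_Ioi fun r hr => ?_).trans
            (by simp)
          exact hH0 s r hs (hst.trans (le_of_lt hr)) h0
      _ = tailIntegral^[ℓ + 1] H (∑ i, generatorInv ψ (x i) + c) := by
          rw [Function.iterate_succ_apply, Fin.sum_univ_succAbove _ 0]
          refine congrArg _ ?_
          change ∑ i, generatorInv ψ (x (Fin.succAbove 0 i)) + _ = _
          ring

end IsNormalizedGenerator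

/-! ### Densities of the marginals and the kernel formula. -/

theorem Copula.measurable_final {d ℓ : ℕ} :
    Measurable (Copula.final : (Fin d → I) → Fin (d - ℓ) → I) :=
  measurable_pi_lambda _ fun _ => measurable_pi_apply _

theorem unitInterval.dense_Ioi_zero : Dense (Ioi (0 : I)) := by
  have : Ioi (0 : I) = {0}ᶜ := by ext x; simp [unitInterval.pos_iff_ne_zero]
  rw [this]
  exact dense_compl_singleton _

namespace IsNormalizedGenerator

variable {d : ℕ} {C : Copula d} {ψ : ℝ → ℝ} (hψ : IsNormalizedGenerator C ψ)
include hψ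

theorem splitMeasure_Iic_prod {ℓ : ℕ} (h : ℓ ≤ d) {x : Fin ℓ → I} (hx : ∀ i, 0 < x i)
    {b : Fin (d - ℓ) → I} (hb : ∀ j, 0 < b j) :
    C.splitMeasure h (Iic x ×ˢ Iic b) =
      ENNReal.ofReal (ψ (∑ i, generatorInv ψ (x i) + ∑ j, generatorInv ψ (b j))) := by
  let z : Fin d → ℝ := fun i =>
    if hi : (i : ℕ) < ℓ then generatorInv ψ (x ⟨i, hi⟩)
    else generatorInv ψ (b ⟨i - ℓ, by omega⟩)
  have hzl : ∀ i : Fin ℓ, z (Fin.castLE h i) = generatorInv ψ (x i) := fun i => by simp [z]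
  have hzr : ∀ j : Fin (d - ℓ), z ⟨ℓ + j, Nat.add_lt_of_lt_sub' j.isLt⟩ = generatorInv ψ (b j) :=
    fun j => by simp [z]
  have hz : ∀ i, 0 ≤ z i := fun i => by
    simp only [z]
    split_ifs <;> exact generatorInv_nonneg _ _
  have hcover : ∀ i : Fin d, (∃ k : Fin ℓ, i = Fin.castLE h k) ∨
      ∃ j : Fin (d - ℓ), i = ⟨ℓ + j, Nat.add_lt_of_lt_sub' j.isLt⟩ := fun i => by
    rcases lt_or_ge (i : ℕ) ℓ with hi | hi
    · exact .inl ⟨⟨i, hi⟩, rfl⟩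
    · exact .inr ⟨⟨i - ℓ, by omega⟩, Fin.ext (by simp; omega)⟩
  have hsum : ∑ i, z i = ∑ i, generatorInv ψ (x i) + ∑ j, generatorInv ψ (b j) := by
    rw [← Equiv.sum_comp (finCongr (Nat.add_sub_of_le h)), Fin.sum_univ_add]
    exact congrArg₂ _ (Finset.sum_congr rfl fun i _ => hzl i)
      (Finset.sum_congr rfl fun j _ => hzr j)
  have hpre : (fun u => (Copula.initial h u, Copula.final u)) ⁻¹' (Iic x ×ˢ Iic b) =
      {u : Fin d → I | ∀ i, (u i : ℝ) ≤ ψ (z i)} := by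
    ext u
    constructor
    · rintro ⟨h1, h2⟩ i
      rcases hcover i with ⟨k, rfl⟩ | ⟨j, rfl⟩
      · rw [hzl, hψ.apply_generatorInv (hx k) (x k).2.2]
        exact h1 k
      · rw [hzr, hψ.apply_generatorInv (hb j) (b j).2.2]
        exact h2 j
    · intro hu
      refine ⟨fun k => ?_, fun j => ?_⟩
      · have := hu (Fin.castLE h k)
        rwa [hzl, hψ.apply_generatorInv (hx k) (x k).2.2] at this
      · have := hu ⟨ℓ + j, Nat.add_lt_of_lt_sub' j.isLt⟩
        rwa [hzr, hψ.apply_generatorInv (hb j) (b j).2.2] at this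
  rw [Copula.splitMeasure, Measure.map_apply ((Copula.measurable_initial h).prodMk
    Copula.measurable_final) (measurableSet_Iic.prod measurableSet_Iic), hpre, ← hsum,
    ← hψ.measureReal_box z hz, ofReal_measureReal]

/-- The density of the marginal on the box `[0, b]` in the remaining coordinates. -/
theorem withDensity_Iic (hd : 2 ≤ d) {ℓ : ℕ} (hℓ : 1 ≤ ℓ) (hℓd : ℓ + 1 ≤ d) {s : ℝ} (hs : 0 ≤ s)
    {x : Fin ℓ → I} (hx : ∀ i, 0 < x i) :
    (volume.withDensity fun u : Fin ℓ → I => (∏ i, generatorWeight ψ (u i)) *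
      generatorDensity ψ ℓ (∑ i, generatorInv ψ (u i) + s)) (Iic x) =
      ENNReal.ofReal (ψ (∑ i, generatorInv ψ (x i) + s)) := by
  obtain ⟨k, rfl⟩ := Nat.exists_eq_add_of_le' hℓ
  rw [withDensity_apply _ measurableSet_Iic, hψ.setLIntegral_prod_generatorWeight hd
    (measurable_generatorDensity ψ k)
    (fun s t hs hst h0 => hψ.generatorDensity_eq_zero hd hs h0 k t hst) hx hs,
    hψ.iterate_tailIntegral_eq hℓ hℓd]
  exact add_nonneg (Finset.sum_nonneg fun i _ => generatorInv_nonneg _ _) hs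

theorem measurable_density {k : ℕ} (s : ℝ) :
    Measurable fun u : Fin (k + 1) → I => (∏ i, generatorWeight ψ (u i)) *
      generatorDensity ψ (k + 1) (∑ i, generatorInv ψ (u i) + s) := by
  refine Measurable.mul ?_ ((measurable_generatorDensity ψ k).comp (Measurable.add_const ?_ s))
  · exact Finset.measurable_prod _ fun i _ =>
      hψ.measurable_generatorWeight.comp (measurable_pi_apply i)
  · exact Finset.measurable_sum _ fun i _ =>
      hψ.measurable_generatorInv_coe.comp (measurable_pi_apply i)

theorem isFiniteMeasure_withDensity (hd : 2 ≤ d) {ℓ : ℕ} (hℓ : 1 ≤ ℓ) (hℓd : ℓ + 1 ≤ d) {s : ℝ}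
    (hs : 0 ≤ s) :
    IsFiniteMeasure (volume.withDensity fun u : Fin ℓ → I => (∏ i, generatorWeight ψ (u i)) *
      generatorDensity ψ ℓ (∑ i, generatorInv ψ (u i) + s)) := by
  refine ⟨?_⟩
  have : (univ : Set (Fin ℓ → I)) = Iic fun _ => 1 :=
    (eq_univ_of_forall fun u i => unitInterval.le_one').symm
  rw [this, hψ.withDensity_Iic hd hℓ hℓd hs fun _ => zero_lt_one]
  exact ENNReal.ofReal_lt_top

theorem marginal_eq_withDensity (hd : 2 ≤ d) {ℓ : ℕ} (hℓ : 1 ≤ ℓ) (hℓd : ℓ + 1 ≤ d) (h : ℓ ≤ d) :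
    (C.marginal h).measure = volume.withDensity fun u : Fin ℓ → I =>
      (∏ i, generatorWeight ψ (u i)) *
        generatorDensity ψ ℓ (∑ i, generatorInv ψ (u i) + 0) := by
  have := hψ.isFiniteMeasure_withDensity hd hℓ hℓd le_rfl
  refine Cube.ext_of_Iic_dense unitInterval.dense_Ioi_zero (mem_Ioi.2 zero_lt_one) fun x hx => ?_
  rw [hψ.withDensity_Iic hd hℓ hℓd le_rfl hx]
  have h1 := hψ.splitMeasure_Iic_prod h hx (b := fun _ => 1) fun _ => zero_lt_one
  simp only [Set.Icc.coe_one, hψ.generatorInv_one, Finset.sum_const_zero] at h1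
  rw [← h1, Copula.splitMeasure, Copula.marginal, Measure.map_apply (Copula.measurable_initial h)
    measurableSet_Iic, Measure.map_apply ((Copula.measurable_initial h).prodMk
    Copula.measurable_final) (measurableSet_Iic.prod measurableSet_Iic)]
  refine congrArg C.measure (Set.ext fun u => ⟨fun hu => ⟨hu, fun j => ?_⟩, fun hu => hu.1⟩)
  exact unitInterval.le_one'

theorem ae_prod_generatorWeight (hd : 2 ≤ d) (ℓ : ℕ) : ∀ᵐ u : Fin ℓ → I,
    ∏ i, generatorWeight ψ (u i) ≠ 0 ∧ ∏ i, generatorWeight ψ (u i) ≠ ∞ := by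
  filter_upwards [ae_cube_mem_Ioo ℓ] with u hu
  refine ⟨Finset.prod_ne_zero_iff.2 fun i _ => ENNReal.inv_ne_zero.2 ENNReal.ofReal_ne_top,
    ENNReal.prod_ne_top fun i _ => ENNReal.inv_ne_top.2 ?_⟩
  have h1 : ψ (generatorInv ψ (u i)) = u i := hψ.apply_generatorInv (hu i).1 (u i).2.2
  refine hψ.generatorDensity_one_ne_zero hd ((generatorInv_nonneg ψ _).lt_of_ne ?_) ?_
  · intro h0
    rw [← h0, hψ.map_zero] at h1
    exact (hu i).2.ne (Subtype.ext h1.symm)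
  · rw [h1]
    exact (hu i).1

/-- The marginal density contains the factor `generatorDensity ψ ℓ`, so the zeros of that factor are
null. This secures the denominator of the kernel formula. -/
theorem ae_marginal (hd : 2 ≤ d) {ℓ : ℕ} (hℓ : 1 ≤ ℓ) (hℓd : ℓ + 1 ≤ d) (h : ℓ ≤ d)
    {p : (Fin ℓ → I) → Prop} (hp : ∀ᵐ x, p x) : ∀ᵐ x ∂(C.marginal h).measure,
    p x ∧ generatorDensity ψ ℓ (∑ i, generatorInv ψ (x i)) ≠ 0 := by
  obtain ⟨k, rfl⟩ := Nat.exists_eq_add_of_le' hℓ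
  rw [hψ.marginal_eq_withDensity hd hℓ hℓd h, ae_withDensity_iff (hψ.measurable_density 0)]
  filter_upwards [hp] with x hx hne
  rw [add_zero] at hne
  exact ⟨hx, right_ne_zero_of_mul hne⟩

/-- The Markov kernel of an Archimedean copula in terms of the derivatives of the generator. -/
theorem ae_density_mul_kernel (hd : 2 ≤ d) {ℓ : ℕ} (hℓ : 1 ≤ ℓ) (hℓd : ℓ + 1 ≤ d) (h : ℓ ≤ d)
    {K : Kernel (Fin ℓ → I) (Fin (d - ℓ) → I)} (hK : C.IsMarkovKernelOf h K)
    {b : Fin (d - ℓ) → I} (hb : ∀ j, 0 < b j) : ∀ᵐ x : Fin ℓ → I,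
    generatorDensity ψ ℓ (∑ i, generatorInv ψ (x i)) * K x (Iic b) =
      generatorDensity ψ ℓ (∑ i, generatorInv ψ (x i) + ∑ j, generatorInv ψ (b j)) := by
  have hμ := hψ.marginal_eq_withDensity hd hℓ hℓd h
  have hs : 0 ≤ ∑ j, generatorInv ψ (b j) := Finset.sum_nonneg fun i _ => generatorInv_nonneg _ _
  obtain ⟨k, rfl⟩ := Nat.exists_eq_add_of_le' hℓ
  have hKm : Measurable fun x => K x (Iic b) := K.measurable_coe measurableSet_Iic
  have := hK.isMarkovKernel
  have hfin := hψ.isFiniteMeasure_withDensity hd hℓ hℓd hs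
  have happly : ∀ s, MeasurableSet s →
      ((C.marginal h).measure.withDensity fun x => K x (Iic b)) s =
        C.splitMeasure h (s ×ˢ Iic b) := fun s hsm => by
    rw [← hK.disintegrate, Measure.compProd_apply_prod hsm measurableSet_Iic,
      withDensity_apply _ hsm]
  have hfin' : IsFiniteMeasure ((C.marginal h).measure.withDensity fun x => K x (Iic b)) := by
    refine MeasureTheory.isFiniteMeasure_withDensity (ne_of_lt ?_)
    calc ∫⁻ x, K x (Iic b) ∂(C.marginal h).measure ≤ ∫⁻ _, 1 ∂(C.marginal h).measure :=
          lintegral_mono fun x => prob_le_one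
      _ < ∞ := by simp
  -- Both measures give a box `Iic x` with positive corner the mass of `Iic x ×ˢ Iic b`; such boxes
  -- determine them, so their densities agree almost everywhere.
  have heq : (C.marginal h).measure.withDensity (fun x => K x (Iic b)) =
      volume.withDensity fun u : Fin (k + 1) → I => (∏ i, generatorWeight ψ (u i)) *
        generatorDensity ψ (k + 1) (∑ i, generatorInv ψ (u i) + ∑ j, generatorInv ψ (b j)) := by
    refine Cube.ext_of_Iic_dense unitInterval.dense_Ioi_zero (mem_Ioi.2 zero_lt_one) fun x hx => ?_
    rw [hψ.withDensity_Iic hd hℓ hℓd hs hx, happly _ measurableSet_Iic,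
      hψ.splitMeasure_Iic_prod h hx hb]
  rw [hμ, ← withDensity_mul _ (hψ.measurable_density 0) hKm, withDensity_eq_iff_of_sigmaFinite
    ((hψ.measurable_density 0).mul hKm).aemeasurable (hψ.measurable_density _).aemeasurable] at heq
  filter_upwards [heq, hψ.ae_prod_generatorWeight hd (k + 1)] with x hx hw
  simp only [Pi.mul_apply, add_zero, mul_assoc] at hx
  exact (ENNReal.mul_right_inj hw.1 hw.2).1 hx

/-- With the other coordinates fixed, a prescribed sum leaves at most one positive value for the
first coordinate. The value 0, where the inverse is a default, is null anyway. -/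
theorem ae_sum_generatorInv_notMem {ℓ : ℕ} (hℓ : 1 ≤ ℓ) {D : Set ℝ} (hD : D.Countable) :
    ∀ᵐ x : Fin ℓ → I, ∑ i, generatorInv ψ (x i) ∉ D := by
  obtain ⟨k, rfl⟩ := Nat.exists_eq_add_of_le' hℓ
  have hφ := hψ.measurable_generatorInv_coe
  have key : ∀ c : ℝ, ∀ᵐ x : Fin (k + 1) → I, ∑ i, generatorInv ψ (x i) ≠ c := by
    intro c
    let e := MeasurableEquiv.piFinSuccAbove (fun _ : Fin (k + 1) => I) 0
    have he : MeasurePreserving e volume volume := volume_preserving_piFinSuccAbove _ 0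
    let S : Set (I × (Fin k → I)) :=
      {p | generatorInv ψ p.1 + ∑ i, generatorInv ψ (p.2 i) = c}
    have hS : MeasurableSet S := by
      refine measurableSet_eq_fun ((hφ.comp measurable_fst).add ?_) measurable_const
      exact Finset.measurable_sum _ fun i _ =>
        hφ.comp ((measurable_pi_apply i).comp measurable_snd)
    have hS0 : volume S = 0 := by
      rw [Measure.volume_eq_prod, Measure.prod_apply_symm hS]
      refine (lintegral_congr fun v => ?_).trans lintegral_zero
      set r := c - ∑ i, generatorInv ψ (v i) with hr
      have hsub : (fun a => (a, v)) ⁻¹' S ⊆ {0} ∪ {a : I | (a : ℝ) = ψ r} := by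
        intro a ha
        rcases eq_or_ne a 0 with h0 | h0
        · exact .inl h0
        · have h1 : generatorInv ψ a = r := eq_sub_of_add_eq ha
          refine .inr ?_
          rw [mem_ofPred_eq, ← h1]
          exact (hψ.apply_generatorInv (unitInterval.pos_iff_ne_zero.2 h0) a.2.2).symm
      refine measure_mono_null hsub (measure_union_null (by simp) ?_)
      exact Set.Subsingleton.measure_zero (fun a ha b hb => Subtype.ext (ha.trans hb.symm)) _
    have hpre : {x : Fin (k + 1) → I | ¬∑ i, generatorInv ψ (x i) ≠ c} = e ⁻¹' S := by
      ext x
      simp only [not_not, mem_ofPred_eq, Fin.sum_univ_succAbove _ (0 : Fin (k + 1))]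
      rfl
    rw [ae_iff, hpre, he.measure_preimage hS.nullMeasurableSet, hS0]
  filter_upwards [(ae_ball_iff hD).2 fun c _ => key c] with x hx hmem
  exact hx _ hmem rfl

end IsNormalizedGenerator

/-! ### The main theorem. -/

theorem corollary4p4 (d : ℕ) (hd : 2 ≤ d) (C : Copula d) (Cn : ℕ → Copula d)
    (hC : C.IsArchimedean) (hCn : ∀ n, (Cn n).IsArchimedean)
    (hconv : TendstoUniformly (fun (n : ℕ) (x : Fin d → I) => Cn n x) (fun x => C x) atTop)
    (ℓ : ℕ) (hℓ : 1 ≤ ℓ) (hℓd : ℓ ≤ d - 1)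
    (K : Kernel (Fin ℓ → I) (Fin (d - ℓ) → I))
    (Kn : ℕ → Kernel (Fin ℓ → I) (Fin (d - ℓ) → I))
    (hK : C.IsMarkovKernelOf (hℓd.trans (d.sub_le 1)) K)
    (hKn : ∀ n, (Cn n).IsMarkovKernelOf (hℓd.trans (d.sub_le 1)) (Kn n)) :
    ∃ Λ : Set (Fin ℓ → I), MeasurableSet Λ ∧
      (C.marginal (hℓd.trans (d.sub_le 1))).measure Λ = 1 ∧
      ∀ x ∈ Λ,
        (∃ U : Set (Fin (d - ℓ) → I), Dense U ∧ ∀ y ∈ U,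
          Tendsto (fun n => (Kn n x).real (Iic y)) atTop (𝓝 ((K x).real (Iic y)))) ∧
        Tendsto (fun n => (hKn n).probAt x) atTop (𝓝 (hK.probAt x)) := by
  have hℓd' : ℓ + 1 ≤ d := by omega
  have h : ℓ ≤ d := hℓd.trans (d.sub_le 1)
  obtain ⟨ψ, hψ⟩ := hC.exists_isNormalizedGenerator
  choose ψn hψn using fun n => (hCn n).exists_isNormalizedGenerator
  obtain ⟨Q₀, hQ₀, hQ₀c, hQ₀d⟩ := unitInterval.dense_Ioi_zero.exists_countable_dense_subset
  let Q : Set I := insert 1 Q₀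
  have hQd : Dense Q := hQ₀d.mono (subset_insert _ _)
  have h1Q : (1 : I) ∈ Q := mem_insert _ _
  have hQpos : ∀ q ∈ Q, 0 < q := by
    rintro q (rfl | hq)
    exacts [zero_lt_one, hQ₀ hq]
  let U : Set (Fin (d - ℓ) → I) := {y | ∀ j, y j ∈ Q}
  have hUpi : U = pi univ fun _ => Q := by ext y; simp [U]
  have hUc : U.Countable := hUpi ▸ countable_univ_pi fun _ => hQ₀c.insert 1
  have hUd : Dense U := hUpi ▸ dense_pi univ fun _ _ => hQd
  obtain ⟨k, rfl⟩ := Nat.exists_eq_add_of_le' hℓ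
  have hmm : ∀ {C : Copula d} {ψ : ℝ → ℝ}, IsNormalizedGenerator C ψ →
      IsMultiplyMonotone 0 (negRightDeriv^[k] ψ) := fun hψ =>
    IsMultiplyMonotone.iterate_negRightDeriv (hψ.isMultiplyMonotone (by omega))
  -- Adding 0 to the discontinuities forces the argument of the derivative to be positive.
  let D : Set ℝ := insert 0 {t | t ∈ Ioi (0 : ℝ) ∧
    ¬ContinuousWithinAt (negRightDeriv (negRightDeriv^[k] ψ)) (Ioi 0) t}
  have hD : D.Countable :=
    ((hmm hψ).antitoneOn_negRightDeriv.countable_not_continuousWithinAt).insert 0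
  have hgood : ∀ᵐ x : Fin (k + 1) → I, (∀ i, 0 < x i) ∧ ∀ y ∈ U,
      ∑ i, generatorInv ψ (x i) + ∑ j, generatorInv ψ (y j) ∉ D ∧
      generatorDensity ψ (k + 1) (∑ i, generatorInv ψ (x i)) * K x (Iic y) =
        generatorDensity ψ (k + 1) (∑ i, generatorInv ψ (x i) + ∑ j, generatorInv ψ (y j)) ∧
      ∀ n, generatorDensity (ψn n) (k + 1) (∑ i, generatorInv (ψn n) (x i)) * Kn n x (Iic y) =
        generatorDensity (ψn n) (k + 1)
          (∑ i, generatorInv (ψn n) (x i) + ∑ j, generatorInv (ψn n) (y j)) := by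
    refine .and ?_ ((ae_ball_iff hUc).2 fun y hy => .and ?_ (.and ?_ (ae_all_iff.2 fun n => ?_)))
    · filter_upwards [ae_cube_mem_Ioo (k + 1)] with x hx i using (hx i).1
    · exact hψ.ae_sum_generatorInv_notMem hℓ (hD.preimage (add_left_injective _))
    · exact hψ.ae_density_mul_kernel hd hℓ hℓd' h hK fun j => hQpos _ (hy j)
    · exact (hψn n).ae_density_mul_kernel hd hℓ hℓd' h (hKn n) fun j => hQpos _ (hy j)
  obtain ⟨t, hsub, ht, ht0⟩ :=
    exists_measurable_superset_of_null (ae_iff.1 (hψ.ae_marginal hd hℓ hℓd' h hgood))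
  refine ⟨tᶜ, ht.compl, (prob_compl_eq_one_iff ht).2 ht0, fun x hx => ?_⟩
  obtain ⟨⟨hx0, hxU⟩, hxG⟩ := not_not.1 fun hn => hx (hsub hn)
  have hφ : ∀ {u : I}, 0 < u →
      Tendsto (fun n => generatorInv (ψn n) u) atTop (𝓝 (generatorInv ψ u)) := fun {u} hu =>
    tendsto_generatorInv hconv hψ hψn hd hu u.2.2
  have hG : ∀ y ∈ U, Tendsto (fun n => generatorDensity (ψn n) (k + 1)
      (∑ i, generatorInv (ψn n) (x i) + ∑ j, generatorInv (ψn n) (y j))) atTop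
      (𝓝 (generatorDensity ψ (k + 1)
        (∑ i, generatorInv ψ (x i) + ∑ j, generatorInv ψ (y j)))) := by
    intro y hy
    have hnot := (hxU y hy).1
    have hpos : 0 < ∑ i, generatorInv ψ (x i) + ∑ j, generatorInv ψ (y j) := by
      refine lt_of_le_of_ne (add_nonneg (Finset.sum_nonneg fun i _ => generatorInv_nonneg _ _)
        (Finset.sum_nonneg fun i _ => generatorInv_nonneg _ _)) fun h0 => hnot (.inl h0.symm)
    have hcont : ContinuousAt (negRightDeriv (negRightDeriv^[k] ψ))
        (∑ i, generatorInv ψ (x i) + ∑ j, generatorInv ψ (y j)) := by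
      by_contra hn
      exact hnot (.inr ⟨hpos, fun hc => hn (hc.continuousAt (Ioi_mem_nhds hpos))⟩)
    unfold generatorDensity
    simp only [Function.iterate_succ_apply']
    refine ENNReal.tendsto_ofReal (IsMultiplyMonotone.tendsto_negRightDeriv
      (fun n => hmm (hψn n)) (hmm hψ) (fun t ht => ?_) hpos ?_ hcont)
    · exact IsMultiplyMonotone.tendsto_iterate_negRightDeriv
        (fun n => (hψn n).isMultiplyMonotone (by omega)) (hψ.isMultiplyMonotone (by omega))
        (fun t ht => tendsto_generator hconv hψ hψn hd ht.le) ht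
    · exact (tendsto_finsetSum _ fun i _ => hφ (hx0 i)).add
        (tendsto_finsetSum _ fun j _ => hφ (hQpos _ (hy j)))
  -- The denominator is the case `y = 1`, where the inverse generator is zero; this is one reason
  -- for putting 1 into `Q`.
  have hG0 : Tendsto (fun n => generatorDensity (ψn n) (k + 1) (∑ i, generatorInv (ψn n) (x i)))
      atTop (𝓝 (generatorDensity ψ (k + 1) (∑ i, generatorInv ψ (x i)))) := by
    simpa [hψ.generatorInv_one, (hψn _).generatorInv_one] using hG (fun _ => 1) fun _ => h1Q
  have hlim : ∀ y ∈ U, Tendsto (fun n => Kn n x (Iic y)) atTop (𝓝 (K x (Iic y))) := by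
    intro y hy
    -- The limiting denominator is nonzero by the choice of `x`, hence so are those of all large
    -- `n`, and the product formulas may be divided.
    have hdiv := ENNReal.Tendsto.div (hG y hy) (.inr hxG) hG0 (.inl ENNReal.ofReal_ne_top)
    rw [← (hxU y hy).2.1, mul_comm,
      ENNReal.mul_div_cancel_right hxG ENNReal.ofReal_ne_top] at hdiv
    refine hdiv.congr' ?_
    filter_upwards [hG0.eventually_ne hxG] with n hn
    rw [← (hxU y hy).2.2 n, mul_comm, ENNReal.mul_div_cancel_right hn ENNReal.ofReal_ne_top]
  refine ⟨⟨U, hUd, fun y hy => ?_⟩, Cube.tendsto_of_tendsto_Iic hQd h1Q fun y hy => hlim y hy⟩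
  have := hK.isMarkovKernel
  exact (ENNReal.tendsto_toReal (measure_ne_top _ _)).comp (hlim y hy)
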